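/- Let $H$ be a complex Hilbert space and let $A:D(A)\subset H\to H$ be a densely defined operator that is self-adjoint or skew-adjoint, with an orthonormal basis $(\varphi_n)_{n\ge1}$ of $H$ consisting of eigenvectors, $A\varphi_n=\lambda_n\varphi_n$. Let $B\in D(A)'$ (a scalar control operator) be such that $b_n:=\langle B,\varphi_n\rangle$ satisfies $0<c\le|b_n|\le C$ for all $n$. Assume that for some $\alpha>1$ and constants $0<c\le C$, $$c\,n^{\alpha-1}\le|\lambda_{n+1}-\lambda_n|\le C\,n^{\alpha-1}\quad(n\ge1),\qquad c\,k^{\alpha-1}|k-n|\le|\lambda_k-\lambda_n|\quad(k,n\ge1).$$ In the self-adjoint case assume $0<-\lambda_1\le-\lambda_2\le\dots\to+\infty$, and in the skew-adjoint case $0<-i\lambda_1\le-i\lambda_2\le\dots\to+\infty$. (In particular $A$ has compact resolvent.) For $s\in\mathbb R$ let $D(A^s)$ be the space with norm $\|f\|_{D(A^s)}^2=\sum_n|\lambda_n|^{2s}|\langle f,\varphi_n\rangle|^2$ (for $s<0$, the dual of $D(A^{-s})$ with pivot space $H$). For $\lambda>0$ with $\lambda\ne\lambda_i-\lambda_j$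 for all $i,j$, put $$\tilde T^{-1}_{i,j}=\frac{\lambda^2}{\lambda_j-\lambda_i-\lambda}\prod_{m\ne i}\Bigl(1+\frac{\lambda}{\lambda_i-\lambda_m}\Bigr)\prod_{n\ne j}\Bigl(1-\frac{\lambda}{\lambda_j-\lambda_n}\Bigr),\qquad k_n=\frac1{b_n}\sum_{j\ge1}\tilde T^{-1}_{n,j},$$ and let $T_\lambda$ be the linear transformation determined by $$T_\lambda\varphi_n=k_n\,(A-(\lambda_n+\lambda)I)^{-1}B=k_n\sum_{p\ge1}\frac{b_p}{\lambda_p-\lambda_n-\lambda}\,\varphi_p .$$ **Self-adjoint case.** There are a constant $C$ and constants $C_s$ such that for every $N\in\mathbb N$ there is a $\lambda\in[N,N+1]$, $\lambda>0$, $\lambda\notin\{\lambda_i-\lambda_j\}$, for which $(k_n)$ is bounded and satisfies the condition $TB=B$ in the form $\sum_n\frac{k_nb_n}{\lambda_j-\lambda_n-\lambda}=1$ for all $j$, and for which, for every $s\in\bigl(\tfrac1{2\alpha}-1,\,1-\tfrac1{2\alpha}\bigr)$, $T_\lambda$ is an isomorphism of $D(A^s)$ with $$\|T_\lambda\|_{\mathcal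 L(D(A^s))}+\|T_\lambda^{-1}\|_{\mathcal L(D(A^s))}\le C_s\,e^{C\lambda^{1/\alpha}} .$$ Here $C$ does not depend on $(s,N,\lambda)$, and $C_s$ does not depend on $(N,\lambda)$; the number $\lambda$ does not depend on $s$. **Skew-adjoint case.** There are a constant $C$ independent of $(s,\lambda)$ and constants $C_s$ independent of $\lambda$ such that for every $\lambda\ge1$ the same conclusions hold ($\lambda\notin\{\lambda_i-\lambda_j\}$, $(k_n)$ is bounded and satisfies $TB=B$ in the form above, and for every $s$ in the same interval $T_\lambda$ is an isomorphism of $D(A^s)$ with the same bound). -/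

import Mathlib

open scoped ComplexConjugate LinearPMap

noncomputable section

namespace Backstepping

/-! Sequences are indexed by `ℕ`; the index `n` stands for the positive integer `n + 1`. -/

section Scale

/-- The coefficient sequences `f = (f_n)` (with `f_n = ⟨f, φ_n⟩`) such that
`∑ |λ_n|^{2s} |f_n|² < ∞`, for a real exponent `s` of any sign. -/
def domPowSubmodule (ev : ℕ → ℂ) (s : ℝ) : Submodule ℂ (ℕ → ℂ) where
  carrier := {f | Memℓp (fun n => ((‖ev n‖ ^ s : ℝ) : ℂ) * f n) 2}
  zero_mem' := by
    simpa [Pi.zero_def] using (zero_memℓp : Memℓp (0 : ∀ _ : ℕ, ℂ) 2)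
  add_mem' := by
    intro f g hf hg
    have h := Memℓp.add hf hg
    simpa [Pi.add_def, mul_add] using h
  smul_mem' := by
    intro c f hf
    have h := Memℓp.const_smul hf c
    simpa [Pi.smul_def, mul_left_comm] using h

/-- The space `D(A^s)` (that is, `D(|A|^s)`) of an operator `A` that is diagonal in an orthonormal
basis `(φ_n)` with eigenvalues `ev n`. An element is given by its coefficients in `(φ_n)`.
For `s ≥ 0` these are the vectors `f` of the Hilbert space with
`∑ |λ_n|^{2s} |⟨f, φ_n⟩|² < ∞`; for `s < 0` this is the dual of `D(A^{-s})` with respect to the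
pivot space, equivalently the completion of the Hilbert space for the norm below. -/
def DomPow (ev : ℕ → ℂ) (s : ℝ) : Type := domPowSubmodule ev s

variable (ev : ℕ → ℂ) (s : ℝ)

instance : AddCommGroup (DomPow ev s) := inferInstanceAs (AddCommGroup (domPowSubmodule ev s))

instance : Module ℂ (DomPow ev s) := inferInstanceAs (Module ℂ (domPowSubmodule ev s))

/-- The coefficient `⟨f, φ_n⟩` of `f ∈ D(A^s)`. -/
def DomPow.coeff {ev : ℕ → ℂ} {s : ℝ} (f : DomPow ev s) (n : ℕ) : ℂ := f.1 n

/-- The map `f ↦ (|λ_n|^s f_n)` from `D(A^s)` to `ℓ²`. -/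
def DomPow.toEllTwo : DomPow ev s →ₗ[ℂ] lp (fun _ : ℕ => ℂ) 2 where
  toFun f := ⟨fun n => ((‖ev n‖ ^ s : ℝ) : ℂ) * f.coeff n, f.2⟩
  map_add' f g := by
    apply Subtype.ext
    funext n
    exact mul_add _ _ _
  map_smul' c f := by
    apply Subtype.ext
    funext n
    exact mul_left_comm _ _ _

/-- The norm of `D(A^s)`: `‖f‖² = ∑ |λ_n|^{2s} |f_n|²`
(a genuine norm as soon as no eigenvalue vanishes). -/
instance : SeminormedAddCommGroup (DomPow ev s) :=
  SeminormedAddCommGroup.induced _ _ (DomPow.toEllTwo ev s)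

instance : NormedSpace ℂ (DomPow ev s) := NormedSpace.induced ℂ _ _ (DomPow.toEllTwo ev s)

theorem DomPow.norm_sq_eq (f : DomPow ev s) :
    ‖f‖ ^ 2 = ∑' n, (‖ev n‖ ^ s * ‖f.coeff n‖) ^ 2 := by
  have h := lp.norm_rpow_eq_tsum (p := 2) (by norm_num) (DomPow.toEllTwo ev s f)
  have h1 : ‖f‖ = ‖DomPow.toEllTwo ev s f‖ := rfl
  have h2 : ∀ n, ‖(DomPow.toEllTwo ev s f : ℕ → ℂ) n‖ = ‖ev n‖ ^ s * ‖f.coeff n‖ := by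
    intro n
    have h3 : (DomPow.toEllTwo ev s f : ℕ → ℂ) n = ((‖ev n‖ ^ s : ℝ) : ℂ) * f.coeff n := rfl
    rw [h3, norm_mul, Complex.norm_real, Real.norm_of_nonneg (by positivity)]
  rw [h1]
  simpa [h2] using h

/-- The eigenvector `φ_n`, as an element of `D(A^s)`. -/
def DomPow.basis (n : ℕ) : DomPow ev s :=
  ⟨Pi.single n 1, by
    refine memℓp_gen (summable_of_ne_finset_zero (s := {n}) ?_)
    intro m hm
    have hm' : m ≠ n := by simpa using hm
    simp [Pi.single_eq_of_ne hm']⟩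

end Scale

section System

variable {H : Type*} [NormedAddCommGroup H] [InnerProductSpace ℂ H] [CompleteSpace H]

/-- The functional framework common to both cases, for a scalar control. The unbounded operator `A`
is diagonal in the orthonormal basis `φ` with eigenvalues `ev`; the control operator
`B ∈ D(A)'` is a conjugate-linear functional on `D(A)`, continuous for the graph norm, whose
coefficients `⟨B, φ_n⟩` are bounded from above and away from zero; the eigenvalues satisfy the
growth and gap conditions of order `α > 1`. -/
structure Framework (A : H →ₗ.[ℂ] H) (B : A.domain →ₛₗ[starRingEnd ℂ] ℂ)
    (φ : HilbertBasis ℕ ℂ H) (ev : ℕ → ℂ) (α : ℝ) : Prop where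
  dense_domain : Dense (A.domain : Set H)
  mem_domain : ∀ n, φ n ∈ A.domain
  eigen : ∀ n, A ⟨φ n, mem_domain n⟩ = ev n • φ n
  continuous_control : ∃ M : ℝ, ∀ v : A.domain, ‖B v‖ ≤ M * (‖(v : H)‖ + ‖A v‖)
  control_bounds : ∃ c C : ℝ, 0 < c ∧
    ∀ n, c ≤ ‖B ⟨φ n, mem_domain n⟩‖ ∧ ‖B ⟨φ n, mem_domain n⟩‖ ≤ C
  one_lt_order : 1 < α
  growth : ∃ c C : ℝ, 0 < c ∧ ∀ n : ℕ,
    c * ((n : ℝ) + 1) ^ (α - 1) ≤ ‖ev (n + 1) - ev n‖ ∧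
      ‖ev (n + 1) - ev n‖ ≤ C * ((n : ℝ) + 1) ^ (α - 1)
  gap : ∃ c : ℝ, 0 < c ∧ ∀ k n : ℕ,
    c * ((k : ℝ) + 1) ^ (α - 1) * |(k : ℝ) - n| ≤ ‖ev k - ev n‖

/-- `A` is self-adjoint and `0 < -λ_1 ≤ -λ_2 ≤ … → +∞`. -/
def SelfAdjointCase (A : H →ₗ.[ℂ] H) (ev : ℕ → ℂ) : Prop :=
  A† = A ∧ ∃ μ : ℕ → ℝ, (∀ n, -ev n = (μ n : ℂ)) ∧
    0 < μ 0 ∧ Monotone μ ∧ Filter.Tendsto μ Filter.atTop Filter.atTop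

/-- `A` is skew-adjoint and `0 < -iλ_1 ≤ -iλ_2 ≤ … → +∞`. -/
def SkewAdjointCase (A : H →ₗ.[ℂ] H) (ev : ℕ → ℂ) : Prop :=
  A† = -A ∧ ∃ μ : ℕ → ℝ, (∀ n, -(Complex.I * ev n) = (μ n : ℂ)) ∧
    0 < μ 0 ∧ Monotone μ ∧ Filter.Tendsto μ Filter.atTop Filter.atTop

/-- `g = (A - z I)⁻¹ B`: the vector `g ∈ H` solves `(A - z I) g = B` in the dual of
`D(A) = D(A*)`, that is `⟨g, (A - z I)* v⟩ = ⟨B, v⟩` for all `v`. (Mathlib's inner product is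
conjugate-linear in its first argument.) -/
def IsResolventOfControl (A : H →ₗ.[ℂ] H) (B : A.domain →ₛₗ[starRingEnd ℂ] ℂ) (z : ℂ) (g : H) :
    Prop :=
  ∀ (v : A.domain) (w : A†.domain), (w : H) = v →
    inner ℂ (A† w - conj z • (w : H)) g = B v

end System

/-- `lam` avoids the differences `λ_i - λ_j` of eigenvalues. -/
def NonResonant (ev : ℕ → ℂ) (lam : ℝ) : Prop := ∀ i j : ℕ, (lam : ℂ) ≠ ev i - ev j

/-- The entry `(i, j)` of the inverse of the infinite Cauchy matrix `1 / (λ_i - λ_j - lam)`: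
`lam² / (λ_j - λ_i - lam) * ∏_{m ≠ i} (1 + lam / (λ_i - λ_m)) * ∏_{n ≠ j} (1 - lam / (λ_j - λ_n))`.
-/
def cauchyInv (ev : ℕ → ℂ) (lam : ℝ) (i j : ℕ) : ℂ :=
  (lam : ℂ) ^ 2 / (ev j - ev i - lam)
    * (∏' m : ℕ, if m = i then 1 else 1 + (lam : ℂ) / (ev i - ev m))
    * (∏' n : ℕ, if n = j then 1 else 1 - (lam : ℂ) / (ev j - ev n))

/-- The feedback coefficients `k_n = K φ_n`, where `b n = ⟨B, φ_n⟩`: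
`k_n b_n` is the sum of the `n`-th row of the inverse Cauchy matrix. -/
def feedbackCoeff (ev b : ℕ → ℂ) (lam : ℝ) (n : ℕ) : ℂ :=
  (∑' j : ℕ, cauchyInv ev lam n j) / b n

/-- The uniqueness condition `T B = B` read on the coefficients, for a bounded sequence `k`:
`∑_n k_n b_n / (λ_j - λ_n - lam) = 1` for every `j`. -/
def UniquenessCondition (ev b : ℕ → ℂ) (lam : ℝ) (k : ℕ → ℂ) : Prop :=
  (∃ M : ℝ, ∀ n, ‖k n‖ ≤ M) ∧
    ∀ j : ℕ, HasSum (fun n => k n * b n / (ev j - ev n - lam)) 1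

section Transformation

variable {H : Type*} [NormedAddCommGroup H] [InnerProductSpace ℂ H] [CompleteSpace H]

/-- The isomorphism `T` of `D(A^s)` is the backstepping transformation
`φ_n ↦ k_n (A - (λ_n + lam) I)⁻¹ B`. -/
def IsBackstepping (A : H →ₗ.[ℂ] H) (B : A.domain →ₛₗ[starRingEnd ℂ] ℂ)
    (φ : HilbertBasis ℕ ℂ H) (ev : ℕ → ℂ) (lam : ℝ) (k : ℕ → ℂ) {s : ℝ}
    (T : DomPow ev s ≃L[ℂ] DomPow ev s) : Prop :=
  ∀ n : ℕ, ∃ g : H, IsResolventOfControl A B (ev n + lam) g ∧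
    ∀ p : ℕ, (T (DomPow.basis ev s n)).coeff p = k n * inner ℂ (φ p) g

/-- At the damping parameter `lam` the transformation `T = T(lam)` is well defined and, for every
`s` with `1/(2α) - 1 < s < 1 - 1/(2α)`, it is an isomorphism of `D(A^s)` with
`‖T‖ + ‖T⁻¹‖ ≤ C_s exp(C lam^{1/α})` for the operator norms of `D(A^s)`. -/
def TransformationCost (A : H →ₗ.[ℂ] H) (B : A.domain →ₛₗ[starRingEnd ℂ] ℂ)
    (φ : HilbertBasis ℕ ℂ H) (ev b : ℕ → ℂ) (α C : ℝ) (Cs : ℝ → ℝ) (lam : ℝ) : Prop :=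
  0 < lam ∧ NonResonant ev lam ∧
  UniquenessCondition ev b lam (feedbackCoeff ev b lam) ∧
  ∀ s ∈ Set.Ioo (1 / (2 * α) - 1) (1 - 1 / (2 * α)),
    ∃ T : DomPow ev s ≃L[ℂ] DomPow ev s,
      IsBackstepping A B φ ev lam (feedbackCoeff ev b lam) T ∧
      ‖(T : DomPow ev s →L[ℂ] DomPow ev s)‖ + ‖(T.symm : DomPow ev s →L[ℂ] DomPow ev s)‖
        ≤ Cs s * Real.exp (C * lam ^ (1 / α))

end Transformation

end Backstepping

end

open scoped ComplexConjugate LinearPMap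

/-! In the basis `φ`, the matrix of `T` is `k_n b_p / (λ_p - λ_n - λ)`: a Cauchy matrix for the
points `λ_p` and `λ_n + λ`, multiplied on both sides by diagonal matrices. Everything rests on the
explicit inverse of such a matrix. For finite sections, Lagrange interpolation at the shifted points
gives the row sums and the inverse (`sum_cauchy_row`, `sum_cauchy_mul_inverse`). Their entries
contain the products `P_n = ∏_{m ≠ n} (1 + λ / (λ_n - λ_m))` and the same products with `-λ`. A
bound on the partial products that is uniform in `n` allows passage to the limit. It follows that
`k_n b_n = -λ P_n`, that `TB = B` holds, and that `T` has an explicit inverse matrix on both sides.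

The exponential cost comes from the products alone. Since `|λ_n - λ_m| ≥ c |n - m|^α`, the logarithm
of a product is at most `2 ∑_d log (1 + λ / (c d^α))`, which is `O(λ^{1/α} + 1)`
(`sum_log_one_add_div_rpow_le`). The denominators cost only a factor of order `λ / δ`, where `δ`
bounds from below the distance from `λ` to the differences of eigenvalues (`inv_norm_shift_le`).
What remains is the kernel `1 / |λ_p - λ_n|`. Conjugated by the weights `|λ_n|^s`, it is dominated
by a Toeplitz kernel plus a rank-one kernel; the latter is bounded on `ℓ²` when `|α s| < α - 1/2`,
which is the stated range of `s` (`exists_ellTwoBounded_weight`).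

In the skew-adjoint case the differences are imaginary, so `δ = 1` works. In the self-adjoint case
only polynomially many differences come near `[N, N + 1]`, and a pigeonhole argument gives `λ` with
`1 / δ` polynomial in `λ` (`exists_nonresonant_separated`). Polynomial factors are absorbed by the
exponential. -/

namespace Backstepping

/-! ### Finite Cauchy matrices by Lagrange interpolation -/

section CauchyMatrix

/-- The factor `1 + z / (a_n - a_m)` for `m ≠ n`, and `1` for `m = n`. -/
noncomputable def cauchyFactor (a : ℕ → ℂ) (z : ℂ) (n m : ℕ) : ℂ :=
  if m = n then 1 else 1 + z / (a n - a m)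

theorem prod_cauchyFactor {a : ℕ → ℂ} (ha : a.Injective) (z : ℂ) {s : Finset ℕ} {n : ℕ}
    (hn : n ∈ s) :
    ∏ m ∈ s, cauchyFactor a z n m = ∏ m ∈ s.erase n, ((a n + z - a m) / (a n - a m)) := by
  rw [← Finset.mul_prod_erase s _ hn]
  have h1 : cauchyFactor a z n n = 1 := by simp [cauchyFactor]
  rw [h1, one_mul]
  refine Finset.prod_congr rfl fun m hm => ?_
  have hmn : m ≠ n := Finset.ne_of_mem_erase hm
  have h2 : a n - a m ≠ 0 := sub_ne_zero.2 fun h => hmn (ha h).symm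
  simp only [cauchyFactor, if_neg hmn]
  field_simp
  ring

/-- In the nodal polynomial at `a n + z` the factor `m = n` equals `z`; the other factors pair with
those of the barycentric weight, whose nodes have the same differences as the `a m`. -/
theorem nodalWeight_shift_mul_eval {a : ℕ → ℂ} (ha : a.Injective) (z : ℂ) {s : Finset ℕ} {n : ℕ}
    (hn : n ∈ s) :
    Lagrange.nodalWeight s (fun n => a n + z) n * (Lagrange.nodal s a).eval (a n + z)
      = z * ∏ m ∈ s, cauchyFactor a z n m := by
  rw [prod_cauchyFactor ha z hn, Lagrange.eval_nodal, Lagrange.nodalWeight,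
    ← Finset.mul_prod_erase s (fun m => a n + z - a m) hn, mul_left_comm,
    ← Finset.prod_mul_distrib]
  congr 1
  · ring
  · refine Finset.prod_congr rfl fun m _ => ?_
    rw [div_eq_inv_mul]
    congr 2
    ring

/-- The nodal polynomials of `a` and of the shifted nodes are both monic, so their difference has
degree below `s.card` and is interpolated exactly at the shifted nodes. Evaluating at `a j`, a root
of the first, gives the identity. -/
theorem sum_cauchy_row {a : ℕ → ℂ} (ha : a.Injective) {z : ℂ} (hz : ∀ i j, a i - a j - z ≠ 0)
    {s : Finset ℕ} {j : ℕ} (hj : j ∈ s) :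
    ∑ n ∈ s, -z * (∏ m ∈ s, cauchyFactor a z n m) / (a j - a n - z) = 1 := by
  set c : ℕ → ℂ := fun n => a n + z with hc
  have hcs : Set.InjOn c s := fun x _ y _ h => ha (by simpa [hc] using h)
  have hdeg : (Lagrange.nodal s a - Lagrange.nodal s c).degree < s.card := by
    refine (Polynomial.degree_sub_lt_left ?_ Lagrange.nodal_ne_zero ?_).trans_eq Lagrange.degree_nodal
    · rw [Lagrange.degree_nodal, Lagrange.degree_nodal]
    · rw [Lagrange.nodal_monic.leadingCoeff, Lagrange.nodal_monic.leadingCoeff]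
  have hne : ∀ i ∈ s, a j ≠ c i := fun i _ h => hz j i (by rw [h]; simp [hc])
  have h := congrArg (Polynomial.eval (a j)) (Lagrange.eq_interpolate hcs hdeg)
  rw [Lagrange.eval_interpolate_not_at_node _ hne] at h
  have hnod : Polynomial.eval (a j) (Lagrange.nodal s c) ≠ 0 := by
    rw [Lagrange.eval_nodal]
    exact Finset.prod_ne_zero_iff.2 fun i hi => sub_ne_zero.2 (hne i hi)
  rw [Polynomial.eval_sub, Lagrange.eval_nodal_at_node hj, zero_sub, ← mul_neg_one] at h
  have h2 := mul_left_cancel₀ hnod h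
  rw [← neg_inj, h2, ← Finset.sum_neg_distrib]
  refine Finset.sum_congr rfl fun i hi => ?_
  rw [Polynomial.eval_sub, Lagrange.eval_nodal_at_node hi, sub_zero, mul_right_comm,
    nodalWeight_shift_mul_eval ha z hi, div_eq_mul_inv]
  have : a j - c i = a j - a i - z := by simp [hc]; ring
  rw [this]
  ring

/-- Interpolate the nodal polynomial of the points `a m`, `m ≠ j`, at the shifted nodes and evaluate
at `a i`. It vanishes for `i ≠ j`; for `i = j` its value fixes the normalizing product with `-z`. -/
theorem sum_cauchy_mul_inverse {a : ℕ → ℂ} (ha : a.Injective) {z : ℂ}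
    (hz : ∀ i j, a i - a j - z ≠ 0) {s : Finset ℕ} {i j : ℕ} (hi : i ∈ s) (hj : j ∈ s) :
    ∑ n ∈ s, z ^ 2 * (∏ m ∈ s, cauchyFactor a z n m) * (∏ m ∈ s, cauchyFactor a (-z) j m)
      / ((a i - a n - z) * (a j - a n - z)) = if i = j then 1 else 0 := by
  set c : ℕ → ℂ := fun n => a n + z with hc
  have hcs : Set.InjOn c s := fun x _ y _ h => ha (by simpa [hc] using h)
  have hdeg : (Lagrange.nodal (s.erase j) a).degree < s.card := by
    rw [Lagrange.degree_nodal]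
    exact_mod_cast Finset.card_erase_lt_of_mem hj
  have hne : ∀ l, ∀ i ∈ s, a l ≠ c i := fun l i _ h => hz l i (by rw [h]; simp [hc])
  have hcn : ∀ l n, a l - c n = a l - a n - z := fun l n => by simp only [hc]; ring
  have h := congrArg (Polynomial.eval (a i)) (Lagrange.eq_interpolate hcs hdeg)
  rw [Lagrange.eval_interpolate_not_at_node _ (hne i)] at h
  have hnod : ∀ l, Polynomial.eval (a l) (Lagrange.nodal s c) ≠ 0 := fun l => by
    rw [Lagrange.eval_nodal]
    exact Finset.prod_ne_zero_iff.2 fun i hi => sub_ne_zero.2 (hne l i hi)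
  have hterm : ∀ n ∈ s, Lagrange.nodalWeight s c n * (a i - c n)⁻¹ *
      Polynomial.eval (c n) (Lagrange.nodal (s.erase j) a)
      = -z * (∏ m ∈ s, cauchyFactor a z n m) / ((a i - a n - z) * (a j - a n - z)) := by
    intro n hn
    have h1 := nodalWeight_shift_mul_eval ha z hn
    rw [Lagrange.nodal_eq_mul_nodal_erase hj, Polynomial.eval_mul] at h1
    have h2 : Polynomial.eval (c n) (Polynomial.X - Polynomial.C (a j)) = -(a j - a n - z) := by
      simp only [Polynomial.eval_sub, Polynomial.eval_X, Polynomial.eval_C, hc]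
      ring
    change Lagrange.nodalWeight s c n * (Polynomial.eval (c n) _ * Polynomial.eval (c n) _) = _ at h1
    rw [h2] at h1
    rw [neg_mul, ← h1, hcn]
    have := hz i n
    have := hz j n
    field_simp
  rw [Finset.sum_congr rfl hterm] at h
  have hQ : -z * ∏ m ∈ s, cauchyFactor a (-z) j m
      = Polynomial.eval (a j) (Lagrange.nodal s c) /
        Polynomial.eval (a j) (Lagrange.nodal (s.erase j) a) := by
    rw [prod_cauchyFactor ha (-z) hj, Lagrange.eval_nodal, Lagrange.eval_nodal,
      ← Finset.mul_prod_erase s (fun m => a j - c m) hj, mul_div_assoc, ← Finset.prod_div_distrib]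
    congr 1
    · simp [hc]
    · refine Finset.prod_congr rfl fun m _ => ?_
      simp only [hc]
      congr 1
      ring
  have hE : Polynomial.eval (a j) (Lagrange.nodal (s.erase j) a) ≠ 0 := by
    rw [Lagrange.eval_nodal]
    exact Finset.prod_ne_zero_iff.2 fun m hm =>
      sub_ne_zero.2 fun h => (Finset.ne_of_mem_erase hm) (ha h).symm
  have hsum : ∑ n ∈ s, z ^ 2 * (∏ m ∈ s, cauchyFactor a z n m) *
      (∏ m ∈ s, cauchyFactor a (-z) j m) / ((a i - a n - z) * (a j - a n - z))
      = (-z * ∏ m ∈ s, cauchyFactor a (-z) j m) *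
        ∑ n ∈ s, -z * (∏ m ∈ s, cauchyFactor a z n m) / ((a i - a n - z) * (a j - a n - z)) := by
    rw [Finset.mul_sum]
    refine Finset.sum_congr rfl fun n _ => ?_
    ring
  rw [hsum, hQ]
  split_ifs with hij
  · subst hij
    rw [div_mul_eq_mul_div, ← h, div_self hE]
  · have h0 : Polynomial.eval (a i) (Lagrange.nodal (s.erase j) a) = 0 :=
      Lagrange.eval_nodal_at_node (Finset.mem_erase.2 ⟨hij, hi⟩)
    rw [h0] at h
    rcases mul_eq_zero.1 h.symm with h | h
    · exact absurd h (hnod i)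
    · rw [h, mul_zero]

end CauchyMatrix

/-! ### Passage to infinite Cauchy matrices -/

section InfiniteCauchyMatrix

/-- The infinite product `∏_{m ≠ n} (1 + z / (a_n - a_m))`. -/
noncomputable def cauchyProd (a : ℕ → ℂ) (z : ℂ) (n : ℕ) : ℂ := ∏' m, cauchyFactor a z n m

/-- Tannery's theorem for truncations in which the terms, and not only the range of summation,
depend on `N`: each term of a finite Cauchy identity contains a partial product. -/
theorem hasSum_of_tendsto_dominated {g : ℕ → ℕ → ℂ} {G : ℕ → ℂ} {bound : ℕ → ℝ} {v : ℂ}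
    (hb : Summable bound) (hg : ∀ n, Filter.Tendsto (fun N => g N n) Filter.atTop (nhds (G n)))
    (hgb : ∀ N n, ‖g N n‖ ≤ bound n)
    (hv : ∀ᶠ N in Filter.atTop, ∑ n ∈ Finset.range N, g N n = v) : HasSum G v := by
  have hGb : ∀ n, ‖G n‖ ≤ bound n := fun n => le_of_tendsto' (hg n).norm fun N => hgb N n
  have hG : Summable G := Summable.of_norm_bounded hb hGb
  have h1 : Filter.Tendsto (fun N => ∑' n, (if n < N then g N n else 0)) Filter.atTop
      (nhds (∑' n, G n)) := by
    refine tendsto_tsum_of_dominated_convergence hb (fun n => ?_) (.of_forall fun N n => ?_)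
    · refine (hg n).congr' ?_
      filter_upwards [Filter.eventually_gt_atTop n] with N hN
      rw [if_pos hN]
    · split_ifs
      · exact hgb N n
      · simpa using (norm_nonneg _).trans (hgb N n)
  have h2 : ∀ N, ∑' n, (if n < N then g N n else 0) = ∑ n ∈ Finset.range N, g N n := by
    intro N
    rw [tsum_eq_sum (s := Finset.range N) (fun n hn => if_neg (by simpa using hn))]
    exact Finset.sum_congr rfl fun n hn => if_pos (Finset.mem_range.1 hn)
  have h3 : ∑' n, G n = v := by
    refine tendsto_nhds_unique h1 (tendsto_const_nhds.congr' ?_)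
    filter_upwards [hv] with N hN
    rw [h2, hN]
  exact h3 ▸ hG.hasSum

variable {a : ℕ → ℂ} {z : ℂ} {δ E : ℝ}

theorem hasSum_cauchy_row (ha : a.Injective) (hδ : 0 < δ) (hz : ∀ i j, δ ≤ ‖a i - a j - z‖)
    (hs : ∀ j, Summable fun n => ‖a j - a n - z‖⁻¹)
    (hm : ∀ n, Multipliable (cauchyFactor a z n))
    (hE : ∀ n N, ‖∏ m ∈ Finset.range N, cauchyFactor a z n m‖ ≤ E) (j : ℕ) :
    HasSum (fun n => -z * cauchyProd a z n / (a j - a n - z)) 1 := by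
  have hz' : ∀ i j, a i - a j - z ≠ 0 := fun i j => norm_pos_iff.1 (hδ.trans_le (hz i j))
  refine hasSum_of_tendsto_dominated
    (g := fun N n => -z * (∏ m ∈ Finset.range N, cauchyFactor a z n m) / (a j - a n - z))
    ((hs j).mul_left (‖z‖ * E)) (fun n => ?_) (fun N n => ?_) ?_
  · exact ((hm n).tendsto_prod_tprod_nat.const_mul _).div_const _
  · rw [norm_div, norm_mul, norm_neg, div_eq_mul_inv]
    gcongr
    exact hE n N
  · filter_upwards [Filter.eventually_gt_atTop j] with N hN
    exact sum_cauchy_row ha hz' (Finset.mem_range.2 hN)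

theorem hasSum_cauchy_mul_inverse (ha : a.Injective) (hδ : 0 < δ)
    (hz : ∀ i j, δ ≤ ‖a i - a j - z‖)
    (hs : ∀ j, Summable fun n => ‖a j - a n - z‖⁻¹)
    (hm : ∀ w : ℂ, ∀ n, Multipliable (cauchyFactor a w n))
    (hE : ∀ n N, ‖∏ m ∈ Finset.range N, cauchyFactor a z n m‖ ≤ E)
    (hE' : ∀ n N, ‖∏ m ∈ Finset.range N, cauchyFactor a (-z) n m‖ ≤ E) (i j : ℕ) :
    HasSum (fun n => z ^ 2 * cauchyProd a z n * cauchyProd a (-z) j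
      / ((a i - a n - z) * (a j - a n - z))) (if i = j then 1 else 0) := by
  have hz' : ∀ i j, a i - a j - z ≠ 0 := fun i j => norm_pos_iff.1 (hδ.trans_le (hz i j))
  have hE0 : 0 ≤ E := (norm_nonneg _).trans (hE 0 0)
  refine hasSum_of_tendsto_dominated
    (g := fun N n => z ^ 2 * (∏ m ∈ Finset.range N, cauchyFactor a z n m) *
      (∏ m ∈ Finset.range N, cauchyFactor a (-z) j m) / ((a i - a n - z) * (a j - a n - z)))
    ((hs i).mul_left (‖z‖ ^ 2 * E * E * δ⁻¹)) (fun n => ?_) (fun N n => ?_) ?_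
  · exact (((hm z n).tendsto_prod_tprod_nat.const_mul _).mul
      (hm (-z) j).tendsto_prod_tprod_nat).div_const _
  · rw [norm_div, norm_mul, norm_mul, norm_mul, norm_pow, div_eq_mul_inv, mul_inv,
      mul_comm ‖a i - a n - z‖⁻¹, ← mul_assoc]
    gcongr
    · exact hE n N
    · exact hE' j N
    · exact hz j n
  · filter_upwards [Filter.eventually_gt_atTop i, Filter.eventually_gt_atTop j] with N hi hj
    exact sum_cauchy_mul_inverse ha hz' (Finset.mem_range.2 hi) (Finset.mem_range.2 hj)

end InfiniteCauchyMatrix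

/-! ### Growth of the products: `exp (O(|z|^{1/α} + 1))` -/

section ProductEstimate

/-- Each distance `d` is attained by at most one `m` on either side of `n`, hence the factor 2. -/
theorem sum_natAbs_sub_le {M : Type*} [AddCommMonoid M] [PartialOrder M] [IsOrderedAddMonoid M]
    {h : ℕ → M} (hh : ∀ d, 0 ≤ h d) (n N : ℕ) :
    ∑ m ∈ Finset.range N, h ((m : ℤ) - n).natAbs ≤ 2 • ∑ d ∈ Finset.range (N + n + 1), h d := by
  rw [← Finset.sum_filter_add_sum_filter_not (Finset.range N) (fun m => m ≤ n), two_nsmul]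
  have key : ∀ s ⊆ Finset.range N, Set.InjOn (fun m : ℕ => ((m : ℤ) - n).natAbs) s →
      ∑ m ∈ s, h ((m : ℤ) - n).natAbs ≤ ∑ d ∈ Finset.range (N + n + 1), h d := by
    intro s hs hinj
    rw [← Finset.sum_image (f := h) hinj]
    refine Finset.sum_le_sum_of_subset_of_nonneg ?_ fun d _ _ => hh d
    intro d hd
    obtain ⟨m, hm, rfl⟩ := Finset.mem_image.1 hd
    have := Finset.mem_range.1 (hs hm)
    simp only [Finset.mem_range]
    omega
  refine add_le_add (key _ (Finset.filter_subset _ _) ?_) (key _ (Finset.filter_subset _ _) ?_)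
  · intro x hx y hy hxy
    simp only [Finset.coe_filter, Set.mem_ofPred_eq, Finset.mem_range] at hx hy hxy
    omega
  · intro x hx y hy hxy
    simp only [Finset.coe_filter, Set.mem_ofPred_eq, Finset.mem_range] at hx hy hxy
    omega

/-- Here the ratio is at least 1, so `1 + y^α ≤ 2 y^α`. The remaining sum of logarithms is `log (M^M
/ M!)`, at most `M` by the exponential series. -/
theorem sum_log_div_rpow_head {α : ℝ} (hα : 0 ≤ α) (M : ℕ) :
    ∑ d ∈ Finset.range M, Real.log (1 + ((M : ℝ) / (d + 1)) ^ α) ≤ (1 + α) * M := by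
  have h1 : ∀ d ∈ Finset.range M, Real.log (1 + ((M : ℝ) / (d + 1)) ^ α)
      ≤ 1 + α * Real.log ((M : ℝ) / (d + 1)) := by
    intro d hd
    have hd' : (d : ℝ) + 1 ≤ M := by exact_mod_cast Finset.mem_range.1 hd
    have hy : 1 ≤ (M : ℝ) / (d + 1) := (one_le_div (by positivity)).2 hd'
    have hy0 : 0 < (M : ℝ) / (d + 1) := by linarith
    have hya : 1 ≤ ((M : ℝ) / (d + 1)) ^ α := Real.one_le_rpow hy hα
    calc Real.log (1 + ((M : ℝ) / (d + 1)) ^ α)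
        ≤ Real.log (2 * ((M : ℝ) / (d + 1)) ^ α) :=
          Real.log_le_log (by positivity) (by linarith)
      _ = Real.log 2 + α * Real.log ((M : ℝ) / (d + 1)) := by
          rw [Real.log_mul (by norm_num) (by positivity), Real.log_rpow hy0]
      _ ≤ _ := by linarith [Real.log_two_lt_d9]
  refine (Finset.sum_le_sum h1).trans ?_
  rw [Finset.sum_add_distrib, ← Finset.mul_sum]
  have h2 : ∑ d ∈ Finset.range M, Real.log ((M : ℝ) / (d + 1)) ≤ M := by
    rcases Nat.eq_zero_or_pos M with rfl | hM
    · simp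
    have hM' : (0 : ℝ) < M := by exact_mod_cast hM
    rw [← Real.log_prod (fun d _ => by positivity), Finset.prod_div_distrib, Finset.prod_const,
      Finset.card_range]
    have h3 : ∏ d ∈ Finset.range M, ((d : ℝ) + 1) = (M.factorial : ℝ) := by
      rw [← Finset.prod_range_add_one_eq_factorial]
      push_cast
      rfl
    rw [h3, Real.log_le_iff_le_exp (by positivity)]
    exact Real.pow_div_factorial_le_exp _ hM'.le M
  simp only [Finset.sum_const, Finset.card_range, nsmul_eq_mul, mul_one]
  nlinarith

/-- Cut into blocks of length `M`: on block number `q` the ratio is at most `1 / (1 + q)`, and `log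
(1 + x) ≤ x`. -/
theorem sum_log_div_rpow_tail {α : ℝ} (hα : 0 ≤ α) {M : ℕ} (hM : 0 < M) (K : ℕ) :
    ∑ d ∈ Finset.range (M * K), Real.log (1 + ((M : ℝ) / ((M + d : ℕ) + 1)) ^ α)
      ≤ M * ∑ q ∈ Finset.range K, (1 + (q : ℝ)) ^ (-α) := by
  have hM' : (0 : ℝ) < M := by exact_mod_cast hM
  induction K with
  | zero => simp
  | succ K ih =>
    rw [Nat.mul_succ, Finset.sum_range_add, Finset.sum_range_succ, mul_add]
    refine add_le_add ih ?_
    have h1 : ∀ r ∈ Finset.range M,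
        Real.log (1 + ((M : ℝ) / ((M + (M * K + r) : ℕ) + 1)) ^ α) ≤ (1 + (K : ℝ)) ^ (-α) := by
      intro r _
      have h2 : (M : ℝ) / ((M + (M * K + r) : ℕ) + 1) ≤ (1 + (K : ℝ))⁻¹ := by
        rw [← one_div, div_le_div_iff₀ (by positivity) (by positivity)]
        push_cast
        have : (0 : ℝ) ≤ r := by positivity
        nlinarith
      have h3 := Real.rpow_le_rpow (by positivity) h2 hα
      rw [Real.inv_rpow (by positivity), ← Real.rpow_neg (by positivity)] at h3
      refine le_trans ?_ h3
      have := Real.log_le_sub_one_of_pos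
        (show 0 < 1 + ((M : ℝ) / ((M + (M * K + r) : ℕ) + 1)) ^ α by positivity)
      linarith
    refine (Finset.sum_le_sum h1).trans ?_
    simp

/-- The sum `∑ (1 + d)^{-α}`. -/
noncomputable def zetaSum (α : ℝ) : ℝ := ∑' d : ℕ, (1 + (d : ℝ)) ^ (-α)

theorem summable_one_add_rpow_neg {α : ℝ} (hα : 1 < α) :
    Summable fun d : ℕ => (1 + (d : ℝ)) ^ (-α) := by
  have h := (summable_nat_add_iff 1).2 (Real.summable_nat_rpow.2 (show -α < -1 by linarith))
  refine h.congr fun d => ?_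
  push_cast
  rw [add_comm]

theorem sum_le_zetaSum {α : ℝ} (hα : 1 < α) (s : Finset ℕ) :
    ∑ d ∈ s, (1 + (d : ℝ)) ^ (-α) ≤ zetaSum α :=
  (summable_one_add_rpow_neg hα).sum_le_tsum s fun _ _ => by positivity

theorem zetaSum_nonneg (α : ℝ) : 0 ≤ zetaSum α := tsum_nonneg fun _ => by positivity

/-- Split at `M`, about `(t / c)^{1/α}`, where `t / (c d^α)` passes through 1. Head and tail are
each at most a constant times `M`. -/
theorem sum_log_one_add_div_rpow_le {α c t : ℝ} (hα : 1 < α) (hc : 0 < c) (ht : 0 ≤ t) (N : ℕ) :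
    ∑ d ∈ Finset.range N, Real.log (1 + t / (c * (d : ℝ) ^ α))
      ≤ (1 + α + zetaSum α) * ((1 / c) ^ (1 / α) * t ^ (1 / α) + 1) := by
  set M : ℕ := ⌊(t / c) ^ (1 / α)⌋₊ + 1 with hMdef
  have hM : 0 < M := Nat.succ_pos _
  have hM' : (0 : ℝ) < M := by exact_mod_cast hM
  have hα0 : (0 : ℝ) < α := by linarith
  have hle : (t / c) ^ (1 / α) ≤ M := by
    rw [hMdef]
    push_cast
    exact (Nat.lt_floor_add_one _).le
  have hle' : (M : ℝ) ≤ (1 / c) ^ (1 / α) * t ^ (1 / α) + 1 := by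
    rw [hMdef, ← Real.mul_rpow (by positivity) ht]
    push_cast
    have : 1 / c * t = t / c := by ring
    rw [this]
    linarith [Nat.floor_le (show 0 ≤ (t / c) ^ (1 / α) by positivity)]
  have htM : t / c ≤ (M : ℝ) ^ α := by
    have h := Real.rpow_le_rpow (by positivity) hle hα0.le
    rwa [← Real.rpow_mul (by positivity), one_div_mul_cancel hα0.ne', Real.rpow_one] at h
  have hnn : ∀ d : ℕ, 0 ≤ Real.log (1 + t / (c * (d : ℝ) ^ α)) := fun d =>
    Real.log_nonneg (by have : 0 ≤ t / (c * (d : ℝ) ^ α) := by positivity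
                        linarith)
  have hsub : Finset.range N ⊆ Finset.range (M + M * N + 1) := by
    intro x hx
    simp only [Finset.mem_range] at hx ⊢
    nlinarith
  refine (Finset.sum_le_sum_of_subset_of_nonneg hsub fun d _ _ => hnn d).trans ?_
  rw [Finset.sum_range_succ']
  -- Division by zero gives 0, so the term `d = 0` vanishes; this fits the factor 1 placed at `m =
  -- n` in the products.
  have h0 : Real.log (1 + t / (c * ((0 : ℕ) : ℝ) ^ α)) = 0 := by
    simp [Real.zero_rpow hα0.ne']
  rw [h0, add_zero]
  have h1 : ∀ d : ℕ, Real.log (1 + t / (c * ((d + 1 : ℕ) : ℝ) ^ α))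
      ≤ Real.log (1 + ((M : ℝ) / (d + 1)) ^ α) := by
    intro d
    refine Real.log_le_log (by positivity) ?_
    rw [Real.div_rpow hM'.le (by positivity), ← div_div]
    push_cast
    gcongr
  refine (Finset.sum_le_sum fun d _ => h1 d).trans ?_
  rw [Finset.sum_range_add]
  have h2 := sum_log_div_rpow_head hα0.le M
  have h3 := sum_log_div_rpow_tail hα0.le hM N
  have h4 : (M : ℝ) * ∑ q ∈ Finset.range N, (1 + (q : ℝ)) ^ (-α) ≤ M * zetaSum α := by
    gcongr
    exact sum_le_zetaSum hα _
  calc _ ≤ (1 + α) * M + M * zetaSum α := add_le_add h2 (h3.trans h4)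
    _ = (1 + α + zetaSum α) * M := by ring
    _ ≤ _ := by
      have := zetaSum_nonneg α
      gcongr

/-- The power gap condition `c |k - n|^α ≤ |a_k - a_n|`. -/
def PowerGap (a : ℕ → ℂ) (α c : ℝ) : Prop :=
  ∀ k n : ℕ, c * |(k : ℝ) - n| ^ α ≤ ‖a k - a n‖

theorem PowerGap.injective {a : ℕ → ℂ} {α c : ℝ} (hc : 0 < c) (h : PowerGap a α c) :
    a.Injective := by
  intro k n hkn
  by_contra hne
  have h1 := h k n
  have h2 : 0 < |(k : ℝ) - n| := abs_pos.2 (sub_ne_zero.2 (by exact_mod_cast hne))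
  have h3 : 0 < c * |(k : ℝ) - n| ^ α := by positivity
  rw [hkn, sub_self, norm_zero] at h1
  linarith

theorem norm_prod_cauchyFactor_le {a : ℕ → ℂ} {α c : ℝ} (hα : 1 < α) (hc : 0 < c)
    (hgap : PowerGap a α c) (z : ℂ) (n N : ℕ) :
    ‖∏ m ∈ Finset.range N, cauchyFactor a z n m‖ ≤
      Real.exp (2 * ((1 + α + zetaSum α) * ((1 / c) ^ (1 / α) * ‖z‖ ^ (1 / α) + 1))) := by
  set h : ℕ → ℝ := fun d => Real.log (1 + ‖z‖ / (c * (d : ℝ) ^ α)) with hh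
  have hpos : ∀ d : ℕ, 0 ≤ ‖z‖ / (c * (d : ℝ) ^ α) := fun d => by positivity
  have hnn : ∀ d, 0 ≤ h d := fun d => Real.log_nonneg (by linarith [hpos d])
  have h1 : ∀ m, ‖cauchyFactor a z n m‖ ≤ Real.exp (h ((m : ℤ) - n).natAbs) := by
    intro m
    rw [hh]
    simp only
    rw [Real.exp_log (by linarith [hpos ((m : ℤ) - n).natAbs]), cauchyFactor]
    split_ifs with hmn
    · rw [norm_one]
      linarith [hpos ((m : ℤ) - n).natAbs]
    · refine (norm_add_le _ _).trans ?_
      rw [norm_one, norm_div]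
      have hd : 0 < |(m : ℝ) - n| := abs_pos.2 (sub_ne_zero.2 (by exact_mod_cast hmn))
      have h2 : (((m : ℤ) - n).natAbs : ℝ) = |(m : ℝ) - n| := by
        rw [Nat.cast_natAbs]; push_cast; rfl
      rw [h2]
      have := hgap m n
      rw [norm_sub_rev] at this
      gcongr
  calc ‖∏ m ∈ Finset.range N, cauchyFactor a z n m‖
      ≤ ∏ m ∈ Finset.range N, ‖cauchyFactor a z n m‖ := Finset.norm_prod_le _ _
    _ ≤ ∏ m ∈ Finset.range N, Real.exp (h ((m : ℤ) - n).natAbs) :=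
        Finset.prod_le_prod (fun _ _ => norm_nonneg _) fun m _ => h1 m
    _ = Real.exp (∑ m ∈ Finset.range N, h ((m : ℤ) - n).natAbs) := (Real.exp_sum _ _).symm
    _ ≤ _ := by
      refine Real.exp_le_exp.2 ((sum_natAbs_sub_le hnn n N).trans ?_)
      rw [nsmul_eq_mul]
      push_cast
      have := sum_log_one_add_div_rpow_le hα hc (norm_nonneg z) (N + n + 1)
      gcongr

end ProductEstimate

/-! ### Nonnegative kernels on `ℓ²` -/

section Kernel

/-- The nonnegative kernel `k` is bounded on `ℓ²` with norm at most `R`. -/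
def EllTwoBounded (k : ℕ → ℕ → ℝ) (R : ℝ) : Prop :=
  ∀ (F S : Finset ℕ) (x : ℕ → ℝ), (∀ n, 0 ≤ x n) →
    ∑ p ∈ F, (∑ n ∈ S, k p n * x n) ^ 2 ≤ R ^ 2 * ∑ n ∈ S, x n ^ 2

/-- Schur's test: Cauchy–Schwarz with weight `k p n` uses the row sums, then exchanging the sums
uses the column sums. -/
theorem EllTwoBounded.of_schur {k : ℕ → ℕ → ℝ} {R : ℝ} (hk : ∀ p n, 0 ≤ k p n)
    (hrow : ∀ p (S : Finset ℕ), ∑ n ∈ S, k p n ≤ R)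
    (hcol : ∀ n (F : Finset ℕ), ∑ p ∈ F, k p n ≤ R) : EllTwoBounded k R := by
  intro F S x hx
  have hR : 0 ≤ R := by simpa using hrow 0 ∅
  have h1 : ∀ p ∈ F, (∑ n ∈ S, k p n * x n) ^ 2 ≤ R * ∑ n ∈ S, k p n * x n ^ 2 := by
    intro p _
    refine (Finset.sum_sq_le_sum_mul_sum_of_sq_le_mul S (fun n _ => hk p n)
      (fun n _ => mul_nonneg (hk p n) (sq_nonneg (x n))) (fun n _ => (by ring : _ = _).le)).trans ?_
    exact mul_le_mul_of_nonneg_right (hrow p S)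
      (Finset.sum_nonneg fun n _ => mul_nonneg (hk p n) (sq_nonneg (x n)))
  refine (Finset.sum_le_sum h1).trans ?_
  rw [← Finset.mul_sum, Finset.sum_comm, sq, mul_assoc]
  refine mul_le_mul_of_nonneg_left ?_ hR
  rw [Finset.mul_sum]
  refine Finset.sum_le_sum fun n _ => ?_
  rw [← Finset.sum_mul]
  exact mul_le_mul_of_nonneg_right (hcol n F) (sq_nonneg _)

theorem EllTwoBounded.of_rank_one {u : ℕ → ℝ} {U : ℝ}
    (hU : ∀ S : Finset ℕ, ∑ n ∈ S, u n ^ 2 ≤ U) : EllTwoBounded (fun p n => u p * u n) U := by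
  intro F S x hx
  have hU0 : 0 ≤ U := by simpa using hU ∅
  have h1 : ∀ p ∈ F, (∑ n ∈ S, u p * u n * x n) ^ 2 ≤ u p ^ 2 * (U * ∑ n ∈ S, x n ^ 2) := by
    intro p _
    have h2 : ∑ n ∈ S, u p * u n * x n = u p * ∑ n ∈ S, u n * x n := by
      rw [Finset.mul_sum]
      exact Finset.sum_congr rfl fun n _ => mul_assoc _ _ _
    rw [h2, mul_pow]
    refine mul_le_mul_of_nonneg_left ?_ (sq_nonneg _)
    refine (Finset.sum_mul_sq_le_sq_mul_sq S u x).trans ?_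
    exact mul_le_mul_of_nonneg_right (hU S) (Finset.sum_nonneg fun n _ => sq_nonneg _)
  refine (Finset.sum_le_sum h1).trans ?_
  rw [← Finset.sum_mul, sq U, mul_assoc]
  refine mul_le_mul_of_nonneg_right (hU F) ?_
  exact mul_nonneg hU0 (Finset.sum_nonneg fun n _ => sq_nonneg _)

theorem EllTwoBounded.add {k l : ℕ → ℕ → ℝ} {R R' : ℝ} (hk : EllTwoBounded k R)
    (hl : EllTwoBounded l R') (hR : 0 ≤ R) (hR' : 0 ≤ R') :
    EllTwoBounded (fun p n => k p n + l p n) (2 * (R + R')) := by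
  intro F S x hx
  have h1 : ∀ p ∈ F, (∑ n ∈ S, (k p n + l p n) * x n) ^ 2
      ≤ 2 * (∑ n ∈ S, k p n * x n) ^ 2 + 2 * (∑ n ∈ S, l p n * x n) ^ 2 := by
    intro p _
    simp only [add_mul, Finset.sum_add_distrib]
    nlinarith [sq_nonneg (∑ n ∈ S, k p n * x n - ∑ n ∈ S, l p n * x n)]
  refine (Finset.sum_le_sum h1).trans ?_
  rw [Finset.sum_add_distrib, ← Finset.mul_sum, ← Finset.mul_sum]
  have h2 := hk F S x hx
  have h3 := hl F S x hx
  have h4 : 0 ≤ ∑ n ∈ S, x n ^ 2 := Finset.sum_nonneg fun n _ => sq_nonneg _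
  have h5 : (R ^ 2 + R' ^ 2) * ∑ n ∈ S, x n ^ 2 ≤ 2 * (R + R') ^ 2 * ∑ n ∈ S, x n ^ 2 := by
    refine mul_le_mul_of_nonneg_right ?_ h4
    nlinarith [mul_nonneg hR hR']
  nlinarith

theorem EllTwoBounded.const_mul {k : ℕ → ℕ → ℝ} {R : ℝ} (hk : EllTwoBounded k R) (A : ℝ) :
    EllTwoBounded (fun p n => A * k p n) (A * R) := by
  intro F S x hx
  have h1 : ∀ p ∈ F, (∑ n ∈ S, A * k p n * x n) ^ 2 = A ^ 2 * (∑ n ∈ S, k p n * x n) ^ 2 := by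
    intro p _
    rw [← mul_pow, Finset.mul_sum]
    simp only [mul_assoc]
  rw [Finset.sum_congr rfl h1, ← Finset.mul_sum, mul_pow, mul_assoc]
  exact mul_le_mul_of_nonneg_left (hk F S x hx) (sq_nonneg _)

theorem sum_one_add_natAbs_sub_rpow_le {α : ℝ} (hα : 1 < α) (n : ℕ) (F : Finset ℕ) :
    ∑ p ∈ F, (1 + (((p : ℤ) - n).natAbs : ℝ)) ^ (-α) ≤ 2 * zetaSum α := by
  obtain ⟨N, hN⟩ : ∃ N, F ⊆ Finset.range N :=
    ⟨F.sup id + 1, fun x hx => Finset.mem_range.2 (Nat.lt_succ_of_le (Finset.le_sup (f := id) hx))⟩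
  refine (Finset.sum_le_sum_of_subset_of_nonneg hN fun _ _ _ => by positivity).trans ?_
  refine (sum_natAbs_sub_le (h := fun d : ℕ => (1 + (d : ℝ)) ^ (-α))
    (fun d => by positivity) n N).trans ?_
  rw [nsmul_eq_mul]
  push_cast
  have := sum_le_zetaSum hα (Finset.range (N + n + 1))
  linarith

theorem ellTwoBounded_toeplitz {α : ℝ} (hα : 1 < α) :
    EllTwoBounded (fun p n => (1 + (((p : ℤ) - n).natAbs : ℝ)) ^ (-α)) (2 * zetaSum α) := by
  refine .of_schur (fun p n => by positivity) (fun p S => ?_)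
    (fun n F => sum_one_add_natAbs_sub_rpow_le hα n F)
  refine (Finset.sum_congr rfl fun n _ => ?_).trans_le (sum_one_add_natAbs_sub_rpow_le hα p S)
  rw [← Int.natAbs_neg, neg_sub]

end Kernel

/-! ### Gap conditions and weighted kernel bounds -/

section Gap

/-- The kernel `1 / |a_p - a_n|` off the diagonal and `1` on it. -/
noncomputable def gapKernel (a : ℕ → ℂ) (p n : ℕ) : ℝ := if p = n then 1 else ‖a p - a n‖⁻¹

theorem gapKernel_nonneg (a : ℕ → ℂ) (p n : ℕ) : 0 ≤ gapKernel a p n := by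
  unfold gapKernel
  split_ifs <;> positivity

theorem gapKernel_comm (a : ℕ → ℂ) (p n : ℕ) : gapKernel a p n = gapKernel a n p := by
  unfold gapKernel
  rw [norm_sub_rev]
  simp only [eq_comm]

/-- If `|a p - a n| ≥ 2 lam`, the shift at most halves the distance; otherwise the distance is at
most `2 lam` and the separation `δ` suffices. On the diagonal the shifted distance is `lam` itself.
-/
theorem inv_norm_shift_le {a : ℕ → ℂ} (ha : a.Injective) {lam δ : ℝ} (hlam : 1 / 2 ≤ lam)
    (hδ : 0 < δ) (hδ1 : δ ≤ 1) (h : ∀ p n, δ ≤ ‖a p - a n - lam‖) (p n : ℕ) :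
    ‖a p - a n - lam‖⁻¹ ≤ 4 * lam / δ * gapKernel a p n := by
  have hlam0 : 0 < lam := by linarith
  have hnl : ‖(lam : ℂ)‖ = lam := by rw [Complex.norm_real, Real.norm_of_nonneg hlam0.le]
  unfold gapKernel
  split_ifs with hpn
  · subst hpn
    rw [sub_self, zero_sub, norm_neg, hnl, mul_one, inv_le_iff_one_le_mul₀ hlam0, div_mul_eq_mul_div,
      one_le_div hδ]
    nlinarith
  · have hpos : 0 < ‖a p - a n‖ := norm_pos_iff.2 (sub_ne_zero.2 fun e => hpn (ha e))
    have hd := h p n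
    rw [← div_eq_mul_inv, div_div, inv_eq_one_div, div_le_div_iff₀ (hδ.trans_le hd) (by positivity),
      one_mul]
    have htri : ‖a p - a n‖ ≤ ‖a p - a n - lam‖ + lam := by
      have := norm_add_le (a p - a n - lam) (lam : ℂ)
      rwa [sub_add_cancel, hnl] at this
    rcases le_total (2 * lam) ‖a p - a n‖ with h2 | h2 <;> nlinarith

theorem gapKernel_le {a : ℕ → ℂ} {α c : ℝ} (hα : 0 ≤ α) (hc : 0 < c) (hgap : PowerGap a α c)
    (p n : ℕ) :
    gapKernel a p n ≤ (1 + 2 ^ α / c) * (1 + (((p : ℤ) - n).natAbs : ℝ)) ^ (-α) := by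
  have h0 : 0 ≤ (2 : ℝ) ^ α / c := by positivity
  unfold gapKernel
  split_ifs with hpn
  · subst hpn
    simpa using h0
  · have hd : 1 ≤ (((p : ℤ) - n).natAbs : ℝ) := by
      have : 1 ≤ ((p : ℤ) - n).natAbs := by omega
      exact_mod_cast this
    have h2 : (((p : ℤ) - n).natAbs : ℝ) = |(p : ℝ) - n| := by
      rw [Nat.cast_natAbs]; push_cast; rfl
    have h3 := hgap p n
    rw [← h2] at h3
    set d : ℝ := (((p : ℤ) - n).natAbs : ℝ)
    have hd0 : 0 < d := by linarith
    calc ‖a p - a n‖⁻¹ ≤ (c * d ^ α)⁻¹ := by gcongr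
      _ = 2 ^ α / c * (2 * d) ^ (-α) := by
        rw [Real.rpow_neg (by positivity), Real.mul_rpow (by norm_num) hd0.le]
        have := Real.rpow_pos_of_pos hd0 α
        field_simp
      _ ≤ (1 + 2 ^ α / c) * (1 + d) ^ (-α) := by
        have h4 : (2 * d) ^ (-α) ≤ (1 + d) ^ (-α) :=
          Real.rpow_le_rpow_of_nonpos (by positivity) (by linarith) (by linarith)
        have h5 : 0 ≤ (1 + d) ^ (-α) := by positivity
        have := mul_le_mul_of_nonneg_left h4 h0
        linarith

theorem summable_gapKernel {a : ℕ → ℂ} {α c : ℝ} (hα : 1 < α) (hc : 0 < c)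
    (hgap : PowerGap a α c) (n : ℕ) : Summable (gapKernel a n) := by
  have h : Summable fun p : ℕ => (1 + (((p : ℤ) - n).natAbs : ℝ)) ^ (-α) :=
    summable_of_sum_le (fun _ => by positivity) (sum_one_add_natAbs_sub_rpow_le hα n)
  refine Summable.of_nonneg_of_le (gapKernel_nonneg a n) (fun p => ?_) (h.mul_left (1 + 2 ^ α / c))
  rw [gapKernel_comm]
  exact gapKernel_le (by linarith) hc hgap p n

theorem multipliable_cauchyFactor {a : ℕ → ℂ} {α c : ℝ} (hα : 1 < α) (hc : 0 < c)
    (hgap : PowerGap a α c) (z : ℂ) (n : ℕ) : Multipliable (cauchyFactor a z n) := by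
  have h1 : cauchyFactor a z n = fun m => 1 + (if m = n then 0 else z / (a n - a m)) := by
    funext m
    unfold cauchyFactor
    split_ifs <;> simp
  rw [h1]
  refine multipliable_one_add_of_summable ?_
  refine Summable.of_nonneg_of_le (fun _ => norm_nonneg _) (fun m => ?_)
    ((summable_gapKernel hα hc hgap n).mul_left ‖z‖)
  unfold gapKernel
  rcases eq_or_ne m n with h | h
  · simp [h]
  · rw [if_neg h, if_neg h.symm, norm_div, div_eq_mul_inv]

theorem norm_cauchyProd_le {a : ℕ → ℂ} {α c : ℝ} (hα : 1 < α) (hc : 0 < c)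
    (hgap : PowerGap a α c) (z : ℂ) (n : ℕ) :
    ‖cauchyProd a z n‖ ≤
      Real.exp (2 * ((1 + α + zetaSum α) * ((1 / c) ^ (1 / α) * ‖z‖ ^ (1 / α) + 1))) :=
  le_of_tendsto' (multipliable_cauchyFactor hα hc hgap z n).tendsto_prod_tprod_nat.norm
    fun N => norm_prod_cauchyFactor_le hα hc hgap z n N

/-- The gap condition `c k^{α-1} |k - n| ≤ |a_k - a_n|`, for indices starting from `0`. -/
def WeightedGap (a : ℕ → ℂ) (α c : ℝ) : Prop :=
  ∀ k n : ℕ, c * ((k : ℝ) + 1) ^ (α - 1) * |(k : ℝ) - n| ≤ ‖a k - a n‖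

/-- By symmetry the weight may be taken at the larger index `k`, and `k + 1 ≥ k - n`. -/
theorem WeightedGap.powerGap {a : ℕ → ℂ} {α c : ℝ} (hα : 1 < α) (hc : 0 < c)
    (h : WeightedGap a α c) : PowerGap a α c := by
  have key : ∀ k n : ℕ, n ≤ k → c * |(k : ℝ) - n| ^ α ≤ ‖a k - a n‖ := by
    intro k n hnk
    refine le_trans ?_ (h k n)
    have hnk' : (n : ℝ) ≤ k := by exact_mod_cast hnk
    have hn : (0 : ℝ) ≤ n := n.cast_nonneg
    rcases hnk'.eq_or_lt with e | hlt
    · rw [e, sub_self, abs_zero, Real.zero_rpow (by linarith)]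
      simp
    rw [abs_of_nonneg (by linarith), mul_assoc]
    have hd : 0 < (k : ℝ) - n := by linarith
    have h1 : ((k : ℝ) - n) ^ α = ((k : ℝ) - n) ^ (α - 1) * ((k : ℝ) - n) := by
      rw [← Real.rpow_add_one hd.ne', sub_add_cancel]
    rw [h1]
    gcongr
    linarith
  intro k n
  rcases le_total n k with hnk | hnk
  · exact key k n hnk
  · rw [abs_sub_comm, norm_sub_rev]
    exact key n k hnk

theorem rpow_div_mul_rpow_neg_le {α σ b P N : ℝ} (hP : 1 ≤ P) (hPN : P ≤ N) (hb : b ≤ α / 2)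
    (hbσ : b ≤ α + σ) : (P / N) ^ σ * N ^ (-α) ≤ P ^ (-b) * N ^ (-b) := by
  have hP0 : 0 < P := by linarith
  have hN0 : 0 < N := by linarith
  have h1 : P ^ σ = P ^ (-b) * P ^ (σ + b) := by
    rw [← Real.rpow_add hP0]; congr 1; ring
  have h2 : P ^ (σ + b) ≤ N ^ (σ + α - b) :=
    (Real.rpow_le_rpow_of_exponent_le hP (by linarith)).trans
      (Real.rpow_le_rpow hP0.le hPN (by linarith))
  have h3 : N ^ (-b) = N ^ (σ + α - b) * (N ^ (-σ) * N ^ (-α)) := by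
    rw [← Real.rpow_add hN0, ← Real.rpow_add hN0]; congr 1; ring
  rw [Real.div_rpow hP0.le hN0.le, div_eq_mul_inv, ← Real.rpow_neg hN0.le, h1, h3, mul_assoc,
    mul_assoc]
  gcongr

/-- If the indices are comparable up to a factor 2, the weight is bounded and the Toeplitz term
suffices. If one is much larger, the gap has the order of its `α`-th power, and the weight is
absorbed into the rank-one term; the two far regimes are exchanged by `σ ↦ -σ`. -/
theorem gapKernel_weight_le {a : ℕ → ℂ} {α c σ : ℝ} (hα : 1 < α) (hc : 0 < c)
    (hgap : WeightedGap a α c) (p n : ℕ) :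
    (((p : ℝ) + 1) / ((n : ℝ) + 1)) ^ σ * gapKernel a p n ≤
      (2 ^ |σ| * (1 + 2 ^ α / c) + 2 / c) * ((1 + (((p : ℤ) - n).natAbs : ℝ)) ^ (-α) +
        (1 + (p : ℝ)) ^ (-min (α / 2) (α - |σ|)) * (1 + (n : ℝ)) ^ (-min (α / 2) (α - |σ|))) := by
  have hfar : ∀ (σ : ℝ) (p n : ℕ), 2 * ((p : ℝ) + 1) < n + 1 →
      (((p : ℝ) + 1) / ((n : ℝ) + 1)) ^ σ * gapKernel a p n ≤
      2 / c * ((1 + (p : ℝ)) ^ (-min (α / 2) (α - |σ|)) *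
        (1 + (n : ℝ)) ^ (-min (α / 2) (α - |σ|))) := by
    intro σ p n hpn
    have hp : (0 : ℝ) ≤ p := p.cast_nonneg
    have hne : p ≠ n := by rintro rfl; linarith
    have h1 := hgap n p
    rw [abs_of_nonneg (by linarith), norm_sub_rev] at h1
    have hN : (0 : ℝ) < (n : ℝ) + 1 := by linarith
    have h2 : c / 2 * ((n : ℝ) + 1) ^ α ≤ ‖a p - a n‖ := by
      refine le_trans ?_ h1
      have e : ((n : ℝ) + 1) ^ α = ((n : ℝ) + 1) ^ (α - 1) * ((n : ℝ) + 1) := by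
        rw [← Real.rpow_add_one hN.ne', sub_add_cancel]
      have e2 : c / 2 * ((n : ℝ) + 1) ^ α = c * ((n : ℝ) + 1) ^ (α - 1) * (((n : ℝ) + 1) / 2) := by
        rw [e]; ring
      rw [e2]
      gcongr
      linarith
    have h3 : gapKernel a p n ≤ 2 / c * ((n : ℝ) + 1) ^ (-α) := by
      rw [gapKernel, if_neg hne]
      calc ‖a p - a n‖⁻¹ ≤ (c / 2 * ((n : ℝ) + 1) ^ α)⁻¹ := by gcongr
        _ = _ := by rw [Real.rpow_neg hN.le, mul_inv, inv_div]
    calc _ ≤ (((p : ℝ) + 1) / ((n : ℝ) + 1)) ^ σ * (2 / c * ((n : ℝ) + 1) ^ (-α)) := by gcongr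
      _ = 2 / c * ((((p : ℝ) + 1) / ((n : ℝ) + 1)) ^ σ * ((n : ℝ) + 1) ^ (-α)) := by ring
      _ ≤ _ := by
        rw [add_comm 1 (p : ℝ), add_comm 1 (n : ℝ)]
        refine mul_le_mul_of_nonneg_left ?_ (by positivity)
        refine rpow_div_mul_rpow_neg_le (by linarith) (by linarith) (min_le_left _ _) ?_
        exact (min_le_right _ _).trans (by linarith [neg_abs_le σ])
  have hτ : 0 ≤ (1 + (((p : ℤ) - n).natAbs : ℝ)) ^ (-α) := by positivity
  have hu : 0 ≤ (1 + (p : ℝ)) ^ (-min (α / 2) (α - |σ|)) *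
    (1 + (n : ℝ)) ^ (-min (α / 2) (α - |σ|)) := by positivity
  have hA : 0 ≤ 2 ^ |σ| * (1 + 2 ^ α / c) := by positivity
  have hB : 0 ≤ 2 / c := by positivity
  have hp : (0 : ℝ) ≤ p := p.cast_nonneg
  have hn : (0 : ℝ) ≤ n := n.cast_nonneg
  rcases lt_or_ge (2 * ((p : ℝ) + 1)) (n + 1) with h1 | h1
  · have := hfar σ p n h1
    nlinarith [mul_nonneg hA hτ, mul_nonneg hA hu, mul_nonneg hB hτ]
  rcases lt_or_ge (2 * ((n : ℝ) + 1)) (p + 1) with h2 | h2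
  · have := hfar (-σ) n p h2
    rw [abs_neg, Real.rpow_neg (by positivity), ← Real.inv_rpow (by positivity), inv_div,
      gapKernel_comm] at this
    nlinarith [mul_nonneg hA hτ, mul_nonneg hA hu, mul_nonneg hB hτ]
  have h3 : (((p : ℝ) + 1) / ((n : ℝ) + 1)) ^ σ ≤ 2 ^ |σ| := by
    rcases le_total 0 σ with hσ | hσ
    · rw [abs_of_nonneg hσ]
      refine Real.rpow_le_rpow (by positivity) ?_ hσ
      rwa [div_le_iff₀ (by positivity)]
    · rw [abs_of_nonpos hσ, ← neg_neg σ, Real.rpow_neg (by positivity),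
        ← Real.inv_rpow (by positivity), inv_div, neg_neg]
      refine Real.rpow_le_rpow (by positivity) ?_ (by linarith)
      rwa [div_le_iff₀ (by positivity)]
  have h4 := gapKernel_le (by linarith) hc (hgap.powerGap hα hc) p n
  have h5 : (((p : ℝ) + 1) / ((n : ℝ) + 1)) ^ σ * gapKernel a p n ≤
      2 ^ |σ| * ((1 + 2 ^ α / c) * (1 + (((p : ℤ) - n).natAbs : ℝ)) ^ (-α)) :=
    mul_le_mul h3 h4 (gapKernel_nonneg a p n) (by positivity)
  nlinarith [mul_nonneg hA hu, mul_nonneg hB hτ, mul_nonneg hB hu]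

theorem rpow_comparison {c C x y X Y s : ℝ} (hc : 0 < c) (hcx : c * X ≤ x) (hxC : x ≤ C * X)
    (hcy : c * Y ≤ y) (hyC : y ≤ C * Y) (hX : 0 < X) (hY : 0 < Y) :
    x ^ s ≤ (C / c) ^ |s| * (X / Y) ^ s * y ^ s := by
  have hx : 0 < x := (mul_pos hc hX).trans_le hcx
  have hy : 0 < y := (mul_pos hc hY).trans_le hcy
  have hC : 0 < C := pos_of_mul_pos_left (hx.trans_le hxC) hX.le
  rcases le_total 0 s with hs | hs
  · rw [abs_of_nonneg hs, ← Real.mul_rpow (by positivity) (by positivity),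
      ← Real.mul_rpow (by positivity) hy.le]
    refine Real.rpow_le_rpow hx.le ?_ hs
    calc x ≤ C * X := hxC
      _ = C / c * (X / Y) * (c * Y) := by field_simp
      _ ≤ _ := by gcongr
  · rw [abs_of_nonpos hs, Real.rpow_neg (by positivity), ← Real.inv_rpow (by positivity), inv_div,
      ← Real.mul_rpow (by positivity) (by positivity),
      ← Real.mul_rpow (by positivity) hy.le]
    refine Real.rpow_le_rpow_of_nonpos (by positivity) ?_ hs
    calc c / C * (X / Y) * y ≤ c / C * (X / Y) * (C * Y) := by gcongr
      _ = c * X := by field_simp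
      _ ≤ x := hcx

theorem exists_ellTwoBounded_weight {a : ℕ → ℂ} {α c c₁ C₁ s : ℝ} (hα : 1 < α) (hc : 0 < c)
    (hgap : WeightedGap a α c) (hc₁ : 0 < c₁)
    (ha : ∀ n : ℕ, c₁ * ((n : ℝ) + 1) ^ α ≤ ‖a n‖ ∧ ‖a n‖ ≤ C₁ * ((n : ℝ) + 1) ^ α)
    (hs : s ∈ Set.Ioo (1 / (2 * α) - 1) (1 - 1 / (2 * α))) :
    ∃ (k : ℕ → ℕ → ℝ) (R : ℝ), 0 ≤ R ∧ (∀ p n, 0 ≤ k p n) ∧ EllTwoBounded k R ∧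
      ∀ p n, ‖a p‖ ^ s * gapKernel a p n ≤ k p n * ‖a n‖ ^ s := by
  have hα0 : 0 < α := by linarith
  have hC₁ : 0 < C₁ := by
    have := ha 0
    simp only [Nat.cast_zero, zero_add, Real.one_rpow, mul_one] at this
    linarith
  set σ := α * s with hσ
  set b := min (α / 2) (α - |σ|) with hb
  have hσ' : |σ| < α - 1 / 2 := by
    have e : α * (1 / (2 * α)) = 1 / 2 := by field_simp
    rw [abs_lt]
    constructor
    · have := mul_lt_mul_of_pos_left hs.1 hα0
      rw [mul_sub, e] at this
      linarith
    · have := mul_lt_mul_of_pos_left hs.2 hα0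
      rw [mul_sub, e] at this
      linarith
  have hb' : 1 < 2 * b := by
    have : 1 / 2 < b := lt_min (by linarith) (by linarith)
    linarith
  have hτ := ellTwoBounded_toeplitz hα
  have hu : EllTwoBounded (fun p n => (1 + (p : ℝ)) ^ (-b) * (1 + (n : ℝ)) ^ (-b))
      (zetaSum (2 * b)) := by
    refine .of_rank_one (u := fun n => (1 + (n : ℝ)) ^ (-b)) fun S => ?_
    refine le_trans (le_of_eq ?_) (sum_le_zetaSum hb' S)
    refine Finset.sum_congr rfl fun n _ => ?_
    rw [← Real.rpow_natCast, ← Real.rpow_mul (by positivity)]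
    congr 1
    push_cast
    ring
  have hζ := zetaSum_nonneg α
  have hζ' := zetaSum_nonneg (2 * b)
  set A := (C₁ / c₁) ^ |s| * (2 ^ |σ| * (1 + 2 ^ α / c) + 2 / c) with hA
  have hA0 : 0 ≤ A := by positivity
  refine ⟨_, _, ?_, fun p n => ?_, (hτ.add hu (by positivity) hζ').const_mul A, fun p n => ?_⟩
  · positivity
  · positivity
  · have hp : (0 : ℝ) < (p : ℝ) + 1 := by positivity
    have hn : (0 : ℝ) < (n : ℝ) + 1 := by positivity
    have h1 := rpow_comparison (s := s) hc₁ (ha p).1 (ha p).2 (ha n).1 (ha n).2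
      (Real.rpow_pos_of_pos hp α) (Real.rpow_pos_of_pos hn α)
    rw [← Real.div_rpow hp.le hn.le, ← Real.rpow_mul (by positivity), ← hσ] at h1
    have h2 := gapKernel_weight_le (σ := σ) hα hc hgap p n
    rw [← hb] at h2
    have hw : 0 ≤ ‖a n‖ ^ s := by positivity
    have hCs : 0 ≤ (C₁ / c₁) ^ |s| := by positivity
    calc ‖a p‖ ^ s * gapKernel a p n
        ≤ (C₁ / c₁) ^ |s| * (((p : ℝ) + 1) / (n + 1)) ^ σ * ‖a n‖ ^ s * gapKernel a p n :=
          mul_le_mul_of_nonneg_right h1 (gapKernel_nonneg a p n)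
      _ = (C₁ / c₁) ^ |s| * ((((p : ℝ) + 1) / (n + 1)) ^ σ * gapKernel a p n) * ‖a n‖ ^ s := by
          ring
      _ ≤ _ := by
        refine (mul_le_mul_of_nonneg_right (mul_le_mul_of_nonneg_left h2 hCs) hw).trans_eq ?_
        rw [hA]
        ring

end Gap

/-! ### Operators on `D(A^s)` defined by matrices -/

section MatrixOperator

variable {ev : ℕ → ℂ} {s : ℝ}

theorem DomPow.ext {f g : DomPow ev s} (h : ∀ n, f.coeff n = g.coeff n) : f = g :=
  Subtype.ext (funext h)

theorem DomPow.summable_sq (f : DomPow ev s) :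
    Summable fun n => (‖ev n‖ ^ s * ‖f.coeff n‖) ^ 2 := by
  have h := (memℓp_gen_iff (p := 2) (by norm_num)).1 f.2
  refine h.congr fun n => ?_
  rw [norm_mul, Complex.norm_real, Real.norm_of_nonneg (by positivity)]
  norm_num
  rfl

theorem DomPow.sum_sq_le (f : DomPow ev s) (S : Finset ℕ) :
    ∑ n ∈ S, (‖ev n‖ ^ s * ‖f.coeff n‖) ^ 2 ≤ ‖f‖ ^ 2 := by
  rw [DomPow.norm_sq_eq]
  exact f.summable_sq.sum_le_tsum S fun _ _ => sq_nonneg _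

/-- The matrix `K` is dominated on `D(A^s)` by the kernel `k`, up to the factor `G`. -/
def DominatedBy (ev : ℕ → ℂ) (s : ℝ) (K : ℕ → ℕ → ℂ) (G : ℝ) (k : ℕ → ℕ → ℝ) : Prop :=
  ∀ p n, ‖ev p‖ ^ s * ‖K p n‖ ≤ G * k p n * ‖ev n‖ ^ s

variable {K L : ℕ → ℕ → ℂ} {G R : ℝ} {k : ℕ → ℕ → ℝ}

/-- The finite-section bound for `k` makes every row series converge absolutely and controls the
weighted norm of the result. -/
theorem DominatedBy.exists_operator (hev : ∀ n, ev n ≠ 0) (hK : DominatedBy ev s K G k)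
    (hG : 0 ≤ G) (hk0 : ∀ p n, 0 ≤ k p n) (hk : EllTwoBounded k R) (hR : 0 ≤ R) :
    ∃ T : DomPow ev s →L[ℂ] DomPow ev s,
      (∀ f p, HasSum (fun n => K p n * f.coeff n) ((T f).coeff p)) ∧ ‖T‖ ≤ G * R := by
  have hw : ∀ n, 0 < ‖ev n‖ ^ s := fun n => Real.rpow_pos_of_pos (norm_pos_iff.2 (hev n)) s
  set x : DomPow ev s → ℕ → ℝ := fun f n => ‖ev n‖ ^ s * ‖f.coeff n‖ with hx
  have hx0 : ∀ f n, 0 ≤ x f n := fun f n => by positivity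
  have hbd : ∀ f (F S : Finset ℕ), ∑ p ∈ F, (∑ n ∈ S, k p n * x f n) ^ 2 ≤ (R * ‖f‖) ^ 2 := by
    intro f F S
    refine (hk F S (x f) (hx0 f)).trans ?_
    rw [mul_pow]
    exact mul_le_mul_of_nonneg_left (f.sum_sq_le S) (sq_nonneg R)
  have hsk : ∀ f p, Summable fun n => k p n * x f n := by
    intro f p
    refine summable_of_sum_le (c := R * ‖f‖) (fun n => mul_nonneg (hk0 p n) (hx0 f n)) fun S => ?_
    have h := hbd f {p} S
    rw [Finset.sum_singleton] at h
    exact abs_le_of_sq_le_sq' h (by positivity) |>.2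
  have hKx : ∀ (f : DomPow ev s) p n, ‖ev p‖ ^ s * ‖K p n * f.coeff n‖ ≤ G * (k p n * x f n) := by
    intro f p n
    rw [norm_mul, ← mul_assoc]
    refine (mul_le_mul_of_nonneg_right (hK p n) (norm_nonneg _)).trans_eq ?_
    simp only [hx]
    ring
  have hsw : ∀ (f : DomPow ev s) p, Summable fun n => ‖ev p‖ ^ s * ‖K p n * f.coeff n‖ := fun f p =>
    Summable.of_nonneg_of_le (fun n => by positivity) (hKx f p) ((hsk f p).mul_left G)
  have hsn : ∀ (f : DomPow ev s) p, Summable fun n => ‖K p n * f.coeff n‖ := fun f p =>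
    (summable_mul_left_iff (hw p).ne').1 (hsw f p)
  have hsm : ∀ (f : DomPow ev s) p, Summable fun n => K p n * f.coeff n := fun f p => (hsn f p).of_norm
  have hle : ∀ (f : DomPow ev s) p, ‖ev p‖ ^ s * ‖∑' n, K p n * f.coeff n‖ ≤ G * ∑' n, k p n * x f n := by
    intro f p
    calc _ ≤ ‖ev p‖ ^ s * ∑' n, ‖K p n * f.coeff n‖ :=
          mul_le_mul_of_nonneg_left (norm_tsum_le_tsum_norm (hsn f p)) (hw p).le
      _ = ∑' n, ‖ev p‖ ^ s * ‖K p n * f.coeff n‖ := tsum_mul_left.symm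
      _ ≤ ∑' n, G * (k p n * x f n) :=
          (hsw f p).tsum_le_tsum (hKx f p) ((hsk f p).mul_left G)
      _ = _ := tsum_mul_left
  have hfin : ∀ (f : DomPow ev s) (F : Finset ℕ), ∑ p ∈ F, (‖ev p‖ ^ s * ‖∑' n, K p n * f.coeff n‖) ^ 2
      ≤ (G * R * ‖f‖) ^ 2 := by
    intro f F
    have h1 : ∑ p ∈ F, (∑' n, k p n * x f n) ^ 2 ≤ (R * ‖f‖) ^ 2 :=
      le_of_tendsto' (tendsto_finsetSum F fun p _ => ((hsk f p).hasSum.pow 2)) fun S => hbd f F S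
    calc _ ≤ ∑ p ∈ F, G ^ 2 * (∑' n, k p n * x f n) ^ 2 := by
          refine Finset.sum_le_sum fun p _ => ?_
          rw [← mul_pow]
          have := hle f p
          gcongr
      _ = G ^ 2 * ∑ p ∈ F, (∑' n, k p n * x f n) ^ 2 := (Finset.mul_sum _ _ _).symm
      _ ≤ G ^ 2 * (R * ‖f‖) ^ 2 := by gcongr
      _ = _ := by ring
  have hmem : ∀ f : DomPow ev s, (fun p => ∑' n, K p n * f.coeff n) ∈ domPowSubmodule ev s := by
    intro f
    refine memℓp_gen' (C := (G * R * ‖f‖) ^ 2) fun F => ?_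
    refine le_trans (le_of_eq ?_) (hfin f F)
    refine Finset.sum_congr rfl fun p _ => ?_
    rw [norm_mul, Complex.norm_real, Real.norm_of_nonneg (hw p).le]
    norm_num
  let T₀ : DomPow ev s →ₗ[ℂ] DomPow ev s :=
    { toFun := fun f => ⟨fun p => ∑' n, K p n * f.coeff n, hmem f⟩
      map_add' := fun f g => by
        apply DomPow.ext
        intro p
        change ∑' n, K p n * (f.coeff n + g.coeff n) = _ + _
        rw [← (hsm f p).tsum_add (hsm g p)]
        exact tsum_congr fun n => mul_add _ _ _
      map_smul' := fun c f => by
        apply DomPow.ext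
        intro p
        change ∑' n, K p n * (c * f.coeff n) = c * _
        rw [← tsum_mul_left]
        exact tsum_congr fun n => mul_left_comm _ _ _ }
  have hT₀ : ∀ f p, (T₀ f).coeff p = ∑' n, K p n * f.coeff n := fun _ _ => rfl
  refine ⟨T₀.mkContinuous (G * R) fun f => ?_, fun f p => ?_,
    LinearMap.mkContinuous_norm_le _ (by positivity) _⟩
  · refine abs_le_of_sq_le_sq' ?_ (by positivity) |>.2
    rw [DomPow.norm_sq_eq]
    exact Real.tsum_le_of_sum_le (fun _ => sq_nonneg _) (hfin f)
  · exact (hsm f p).hasSum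

theorem DominatedBy.exists_equiv (hev : ∀ n, ev n ≠ 0) (hK : DominatedBy ev s K G k)
    (hL : DominatedBy ev s L G k) (hG : 0 ≤ G)
    (hk0 : ∀ p n, 0 ≤ k p n) (hk : EllTwoBounded k R) (hR : 0 ≤ R)
    (hKL : ∀ i j, HasSum (fun n => K i n * L n j) (if i = j then 1 else 0))
    (hLK : ∀ i j, HasSum (fun n => L i n * K n j) (if i = j then 1 else 0)) :
    ∃ T : DomPow ev s ≃L[ℂ] DomPow ev s,
      (∀ n p, (T (DomPow.basis ev s n)).coeff p = K p n) ∧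
      ‖(T : DomPow ev s →L[ℂ] DomPow ev s)‖ + ‖(T.symm : DomPow ev s →L[ℂ] DomPow ev s)‖
        ≤ 2 * (G * R) := by
  have comp : ∀ {K L : ℕ → ℕ → ℂ} (_ : DominatedBy ev s K G k) (_ : DominatedBy ev s L G k)
      (_ : ∀ i j, HasSum (fun n => K i n * L n j) (if i = j then 1 else 0))
      (T S : DomPow ev s →L[ℂ] DomPow ev s)
      (_ : ∀ f p, HasSum (fun n => K p n * f.coeff n) ((T f).coeff p))
      (_ : ∀ f p, HasSum (fun n => L p n * f.coeff n) ((S f).coeff p)) (f : DomPow ev s),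
      T (S f) = f := by
    intro K L hK hL hKL T S hT hS f
    have abs_dom : ∀ {K : ℕ → ℕ → ℂ}, DominatedBy ev s K G k →
        DominatedBy ev s (fun p n => (‖K p n‖ : ℂ)) G k := by
      intro K hK p n
      simpa using hK p n
    -- The matrices of absolute values satisfy the same domination. Applying their operators to
    -- `|f|` gives the absolute summability needed to exchange the two sums in `T (S f)`.
    obtain ⟨T', hT', -⟩ := (abs_dom hK).exists_operator hev hG hk0 hk hR
    obtain ⟨S', hS', -⟩ := (abs_dom hL).exists_operator hev hG hk0 hk hR
    let f' : DomPow ev s := ⟨fun n => (‖f.coeff n‖ : ℂ), by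
      refine (memℓp_gen_iff (p := 2) (by norm_num)).2
        (((memℓp_gen_iff (p := 2) (by norm_num)).1 f.2).congr fun n => ?_)
      simp [DomPow.coeff]⟩
    have hf' : ∀ n, f'.coeff n = (‖f.coeff n‖ : ℂ) := fun _ => rfl
    have hS1 : ∀ n, HasSum (fun j => ‖L n j * f.coeff j‖) (((S' f').coeff n).re) := by
      intro n
      have h := Complex.hasSum_re (hS' f' n)
      refine h.congr_fun fun j => ?_
      rw [hf', ← Complex.ofReal_mul, Complex.ofReal_re, norm_mul]
    apply DomPow.ext
    intro i
    have hsum : Summable fun q : ℕ × ℕ => K i q.1 * (L q.1 q.2 * f.coeff q.2) := by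
      refine Summable.of_norm ((summable_prod_of_nonneg fun _ => norm_nonneg _).2 ⟨fun n => ?_, ?_⟩)
      · simp only [norm_mul (K i n)]
        exact (hS1 n).summable.mul_left _
      · have h := (Complex.hasSum_re (hT' (S' f') i)).summable
        refine h.congr fun n => ?_
        simp only [norm_mul (K i n)]
        rw [tsum_mul_left, (hS1 n).tsum_eq, Complex.re_ofReal_mul]
    rw [← (hT (S f) i).tsum_eq]
    calc ∑' n, K i n * (S f).coeff n = ∑' n, ∑' j, K i n * (L n j * f.coeff j) :=
          tsum_congr fun n => by rw [← (hS f n).tsum_eq, tsum_mul_left]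
      _ = ∑' j, ∑' n, K i n * (L n j * f.coeff j) := Summable.tsum_comm hsum.prod_symm
      _ = ∑' j, (if i = j then 1 else 0) * f.coeff j := tsum_congr fun j => by
          rw [← (hKL i j).tsum_eq, ← tsum_mul_right]
          exact tsum_congr fun n => (mul_assoc _ _ _).symm
      _ = f.coeff i := by
          rw [tsum_eq_single i fun j hj => by simp [hj.symm]]
          simp
  obtain ⟨T, hT, hTn⟩ := hK.exists_operator hev hG hk0 hk hR
  obtain ⟨S, hS, hSn⟩ := hL.exists_operator hev hG hk0 hk hR
  refine ⟨ContinuousLinearEquiv.equivOfInverse T S (comp hL hK hLK S T hS hT)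
    (comp hK hL hKL T S hT hS), fun n p => ?_, ?_⟩
  · change (T (DomPow.basis ev s n)).coeff p = K p n
    rw [← (hT _ p).tsum_eq, tsum_eq_single n fun m hm => ?_]
    · simp [DomPow.coeff, DomPow.basis]
    · simp [DomPow.coeff, DomPow.basis, Pi.single_eq_of_ne hm]
  · calc _ = ‖T‖ + ‖S‖ := rfl
      _ ≤ _ := by linarith

end MatrixOperator

/-! ### The transformation and its inverse for separated `lam` -/

section Core

variable {ev b : ℕ → ℂ} {α c c₁ C₁ cb Cb : ℝ}

theorem cauchyInv_eq (ev : ℕ → ℂ) (lam : ℝ) (i j : ℕ) :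
    cauchyInv ev lam i j =
      (lam : ℂ) ^ 2 / (ev j - ev i - lam) * cauchyProd ev lam i * cauchyProd ev (-lam) j := by
  have h : ∀ n, (if n = j then (1 : ℂ) else 1 - (lam : ℂ) / (ev j - ev n))
      = cauchyFactor ev (-lam) j n := by
    intro n
    rw [cauchyFactor, neg_div, sub_eq_add_neg]
  simp only [cauchyInv, h]
  rfl

/-- Estimate of the transformation for a damping parameter `lam` at distance at least `δ` from the
differences of eigenvalues. -/
theorem exists_transformation (hα : 1 < α) (hc : 0 < c)
    (hgap : WeightedGap ev α c) (hc₁ : 0 < c₁)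
    (hev : ∀ n : ℕ, c₁ * ((n : ℝ) + 1) ^ α ≤ ‖ev n‖ ∧ ‖ev n‖ ≤ C₁ * ((n : ℝ) + 1) ^ α)
    (hcb : 0 < cb) (hb : ∀ n, cb ≤ ‖b n‖ ∧ ‖b n‖ ≤ Cb) :
    ∃ (C : ℝ) (Cs : ℝ → ℝ), (∀ s, 0 ≤ Cs s) ∧ ∀ lam δ : ℝ, 1 / 2 ≤ lam → 0 < δ → δ ≤ 1 →
      (∀ p n, δ ≤ ‖ev p - ev n - lam‖) →
      UniquenessCondition ev b lam (feedbackCoeff ev b lam) ∧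
      (∀ n, Summable fun p => b p / (ev p - ev n - lam)) ∧
      ∀ s ∈ Set.Ioo (1 / (2 * α) - 1) (1 - 1 / (2 * α)),
        ∃ T : DomPow ev s ≃L[ℂ] DomPow ev s,
          (∀ n p, (T (DomPow.basis ev s n)).coeff p =
            feedbackCoeff ev b lam n * (b p / (ev p - ev n - lam))) ∧
          ‖(T : DomPow ev s →L[ℂ] DomPow ev s)‖ + ‖(T.symm : DomPow ev s →L[ℂ] DomPow ev s)‖
            ≤ Cs s * (lam ^ 2 / δ) * Real.exp (C * lam ^ (1 / α)) := by
  -- The norm `R` is chosen for each `s` before `lam` and `δ` appear, so that `Cs` does not depend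
  -- on them; 0 is a default value outside the interval.
  have hweight : ∀ s, ∃ R : ℝ, 0 ≤ R ∧ (s ∈ Set.Ioo (1 / (2 * α) - 1) (1 - 1 / (2 * α)) →
      ∃ k : ℕ → ℕ → ℝ, (∀ p n, 0 ≤ k p n) ∧ EllTwoBounded k R ∧
        ∀ p n, ‖ev p‖ ^ s * gapKernel ev p n ≤ k p n * ‖ev n‖ ^ s) := by
    intro s
    by_cases hs : s ∈ Set.Ioo (1 / (2 * α) - 1) (1 - 1 / (2 * α))
    · obtain ⟨k, R, hR, hk⟩ := exists_ellTwoBounded_weight hα hc hgap hc₁ hev hs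
      exact ⟨R, hR, fun _ => ⟨k, hk⟩⟩
    · exact ⟨0, le_rfl, fun h => absurd h hs⟩
  choose R hR0 hR using hweight
  have hpg := hgap.powerGap hα hc
  have hinj := hpg.injective hc
  have hev0 : ∀ n, ev n ≠ 0 := fun n => norm_pos_iff.1
    ((mul_pos hc₁ (Real.rpow_pos_of_pos (by positivity) α)).trans_le (hev n).1)
  have hb0 : ∀ n, b n ≠ 0 := fun n => norm_pos_iff.1 (hcb.trans_le (hb n).1)
  have hCb : 0 ≤ Cb := (norm_nonneg _).trans (hb 0).2
  set Z := 1 + α + zetaSum α with hZ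
  refine ⟨2 * (Z * (1 / c) ^ (1 / α)),
    fun s => 8 * Real.exp (2 * Z) * (Cb / cb) * R s, fun s => ?_, ?_⟩
  · have := hR0 s
    positivity
  intro lam δ hlam hδ hδ1 hres
  have hlam0 : 0 < lam := by linarith
  have hnl : ‖(lam : ℂ)‖ = lam := by rw [Complex.norm_real, Real.norm_of_nonneg hlam0.le]
  set E := Real.exp (2 * (Z * ((1 / c) ^ (1 / α) * lam ^ (1 / α) + 1))) with hE
  have hE0 : 0 < E := Real.exp_pos _
  have hP : ∀ n N, ‖∏ m ∈ Finset.range N, cauchyFactor ev lam n m‖ ≤ E := fun n N => by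
    simpa only [hnl] using norm_prod_cauchyFactor_le hα hc hpg lam n N
  have hQ : ∀ n N, ‖∏ m ∈ Finset.range N, cauchyFactor ev (-lam) n m‖ ≤ E := fun n N => by
    simpa only [norm_neg, hnl] using norm_prod_cauchyFactor_le hα hc hpg (-lam) n N
  have hP' : ∀ n, ‖cauchyProd ev lam n‖ ≤ E := fun n => by
    simpa only [hnl] using norm_cauchyProd_le hα hc hpg lam n
  have hQ' : ∀ n, ‖cauchyProd ev (-lam) n‖ ≤ E := fun n => by
    simpa only [norm_neg, hnl] using norm_cauchyProd_le hα hc hpg (-lam) n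
  have hm := multipliable_cauchyFactor hα hc hpg
  have hinv := inv_norm_shift_le hinj hlam hδ hδ1 hres
  have hswap : ∀ p n, ‖ev p - ev n - -(lam : ℂ)‖ = ‖ev n - ev p - lam‖ := fun p n => by
    rw [← norm_neg]; congr 1; ring
  have hne : ∀ p n, ev p - ev n - lam ≠ 0 := fun p n => norm_pos_iff.1 (hδ.trans_le (hres p n))
  have hne' : ∀ p n, ev p - ev n - -(lam : ℂ) ≠ 0 := fun p n =>
    norm_pos_iff.1 (by rw [hswap]; exact hδ.trans_le (hres n p))
  have hs₁ : ∀ j, Summable fun n => ‖ev j - ev n - lam‖⁻¹ := fun j =>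
    Summable.of_nonneg_of_le (fun n => by positivity) (hinv j)
      ((summable_gapKernel hα hc hpg j).mul_left _)
  have hs₂ : ∀ j, Summable fun n => ‖ev j - ev n - -(lam : ℂ)‖⁻¹ := fun j =>
    Summable.of_nonneg_of_le (fun n => by positivity)
      (fun n => by rw [hswap, gapKernel_comm]; exact hinv n j)
      ((summable_gapKernel hα hc hpg j).mul_left _)
  have hres' : ∀ p n, δ ≤ ‖ev p - ev n - -(lam : ℂ)‖ := fun p n => by
    rw [hswap]; exact hres n p
  -- The sum of a row of the inverse matrix is the row identity for the shift `-lam`, multiplied by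
  -- `-lam * cauchyProd ev lam n`.
  have hk : ∀ n, feedbackCoeff ev b lam n = -lam * cauchyProd ev lam n / b n := by
    intro n
    have h := (hasSum_cauchy_row hinj hδ hres' hs₂ (hm (-lam)) hQ n).mul_left
      (-lam * cauchyProd ev lam n)
    rw [mul_one] at h
    rw [feedbackCoeff, ← h.tsum_eq]
    congr 1
    refine tsum_congr fun j => ?_
    rw [cauchyInv_eq]
    have e : ev n - ev j - -(lam : ℂ) = -(ev j - ev n - lam) := by ring
    rw [e, div_neg]
    have := hne j n
    field_simp
  have hkb : ∀ n, ‖feedbackCoeff ev b lam n‖ ≤ lam * E / cb := by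
    intro n
    rw [hk, norm_div, norm_mul, norm_neg, hnl]
    have := hP' n
    have := (hb n).1
    gcongr
  refine ⟨⟨⟨_, hkb⟩, fun j => ?_⟩, fun n => ?_, fun s hs => ?_⟩
  · refine (hasSum_cauchy_row hinj hδ hres hs₁ (hm lam) hP j).congr_fun fun n => ?_
    rw [hk, div_mul_cancel₀ _ (hb0 n)]
  · refine Summable.of_norm_bounded ((hs₂ n).mul_left Cb) fun p => ?_
    rw [norm_div, div_eq_mul_inv, hswap]
    exact mul_le_mul_of_nonneg_right (hb p).2 (by positivity)
  obtain ⟨k, hk0, hkR, hkw⟩ := hR s hs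
  set G := lam * E / cb * Cb * (4 * lam / δ) with hG
  have hG0 : 0 ≤ G := by positivity
  have hdom : ∀ K : ℕ → ℕ → ℂ, (∀ p n, ‖K p n‖ ≤ G * gapKernel ev p n) →
      DominatedBy ev s K G k := by
    intro K hK p n
    calc ‖ev p‖ ^ s * ‖K p n‖ ≤ ‖ev p‖ ^ s * (G * gapKernel ev p n) := by
          have := hK p n
          gcongr
      _ = G * (‖ev p‖ ^ s * gapKernel ev p n) := by ring
      _ ≤ G * (k p n * ‖ev n‖ ^ s) := mul_le_mul_of_nonneg_left (hkw p n) hG0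
      _ = _ := by ring
  have hK : DominatedBy ev s
      (fun p n => feedbackCoeff ev b lam n * (b p / (ev p - ev n - lam))) G k := by
    refine hdom _ fun p n => ?_
    rw [norm_mul, norm_div, div_eq_mul_inv ‖b p‖, ← mul_assoc, hG, mul_assoc _ _ (gapKernel ev p n)]
    have h1 := hkb n
    have h2 := (hb p).2
    have h3 := hinv p n
    gcongr
  have hL : DominatedBy ev s
      (fun n j => -lam * b n * cauchyProd ev (-lam) j / b j / (ev j - ev n - lam)) G k := by
    refine hdom _ fun n j => ?_
    rw [norm_div, norm_div, norm_mul, norm_mul, norm_neg, hnl, div_eq_mul_inv _ ‖ev j - _ - _‖, hG,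
      mul_assoc _ _ (gapKernel ev n j)]
    have h1 := (hb n).2
    have h2 := (hb j).1
    have h3 := hinv j n
    rw [gapKernel_comm] at h3
    have h4 := hQ' j
    calc lam * ‖b n‖ * ‖cauchyProd ev (-lam) j‖ / ‖b j‖ * ‖ev j - ev n - lam‖⁻¹
        ≤ lam * Cb * E / cb * (4 * lam / δ * gapKernel ev n j) := by gcongr
      _ = _ := by ring
  have hδij : ∀ i j : ℕ, b i / b j * (if i = j then 1 else 0) = if i = j then 1 else 0 := by
    intro i j
    split_ifs with h
    · rw [h, div_self (hb0 j), mul_one]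
    · rw [mul_zero]
  have hKL : ∀ i j, HasSum (fun n => feedbackCoeff ev b lam n * (b i / (ev i - ev n - lam)) *
      (-lam * b n * cauchyProd ev (-lam) j / b j / (ev j - ev n - lam)))
      (if i = j then 1 else 0) := by
    intro i j
    have h := (hasSum_cauchy_mul_inverse hinj hδ hres hs₁ hm hP hQ i j).mul_left (b i / b j)
    rw [hδij] at h
    refine h.congr_fun fun n => ?_
    rw [hk]
    have := hb0 n
    have := hb0 j
    have := hne i n
    have := hne j n
    field_simp
  -- The other product of the two matrices is the same identity with shift `-lam`, which exchanges
  -- the two families of products.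
  have hLK : ∀ i j, HasSum (fun n =>
      -lam * b i * cauchyProd ev (-lam) n / b n / (ev n - ev i - lam) *
      (feedbackCoeff ev b lam j * (b n / (ev n - ev j - lam)))) (if i = j then 1 else 0) := by
    intro i j
    have h := (hasSum_cauchy_mul_inverse hinj hδ hres' hs₂ hm hQ (by simpa using hP) i j).mul_left
      (b i / b j)
    rw [hδij] at h
    refine h.congr_fun fun n => ?_
    have e : ∀ i, ev i - ev n - -(lam : ℂ) = -(ev n - ev i - lam) := fun i => by ring
    rw [hk, e, e, neg_neg]
    have := hb0 n
    have := hb0 j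
    have := hne n i
    have := hne n j
    field_simp
  obtain ⟨T, hT, hTn⟩ := hK.exists_equiv hev0 hL hG0 hk0 hkR (hR0 s) hKL hLK
  refine ⟨T, hT, hTn.trans_eq ?_⟩
  have e : E = Real.exp (2 * Z) * Real.exp (2 * (Z * (1 / c) ^ (1 / α)) * lam ^ (1 / α)) := by
    rw [hE, ← Real.exp_add]
    congr 1
    ring
  rw [hG, e]
  ring

/-- With `y = x^{1/α}`, the left side is at most a constant times a power of `1 + y`, and hence a
constant times `exp y`. -/
theorem exists_one_add_rpow_le_exp {r : ℝ} (hα : 1 < α) (hr : 0 ≤ r) :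
    ∃ K : ℝ, 0 ≤ K ∧ ∀ x : ℝ, 0 ≤ x → (1 + x) ^ r ≤ K * Real.exp (x ^ (1 / α)) := by
  have hα0 : 0 < α := by linarith
  set m := ⌈α * r⌉₊
  refine ⟨2 ^ r * (m.factorial * Real.exp 1), by positivity, fun x hx => ?_⟩
  set y := x ^ (1 / α) with hy
  have hy0 : 0 ≤ y := by positivity
  have hxy : x = y ^ α := by
    rw [hy, ← Real.rpow_mul hx, one_div_mul_cancel hα0.ne', Real.rpow_one]
  have h1 : 1 + x ≤ 2 * (1 + y) ^ α := by
    have h2 : 1 ≤ (1 + y) ^ α := Real.one_le_rpow (by linarith) hα0.le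
    have h3 : y ^ α ≤ (1 + y) ^ α := Real.rpow_le_rpow hy0 (by linarith) hα0.le
    linarith
  calc (1 + x) ^ r ≤ (2 * (1 + y) ^ α) ^ r := Real.rpow_le_rpow (by linarith) h1 hr
    _ = 2 ^ r * (1 + y) ^ (α * r) := by
      rw [Real.mul_rpow (by norm_num) (by positivity), ← Real.rpow_mul (by positivity)]
    _ ≤ 2 ^ r * (1 + y) ^ m := by
      gcongr
      rw [← Real.rpow_natCast]
      exact Real.rpow_le_rpow_of_exponent_le (by linarith) (Nat.le_ceil _)
    _ ≤ 2 ^ r * (m.factorial * Real.exp (1 + y)) := by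
      have h := Real.pow_div_factorial_le_exp (1 + y) (by linarith) m
      rw [div_le_iff₀ (by positivity)] at h
      gcongr
      linarith
    _ = _ := by rw [Real.exp_add]; ring

/-- Pigeonhole: among `K + 1` candidates spaced by `2δ`, a point of `T` is within `δ` of at most
one. The value of `δ` keeps all candidates in an interval of length `1/2`. -/
theorem exists_separated (T : Finset ℝ) {K : ℕ} (hT : T.card ≤ K) (x : ℝ) :
    ∃ y ∈ Set.Icc x (x + 1 / 2), ∀ t ∈ T, 1 / (4 * ((K : ℝ) + 1)) ≤ |t - y| := by
  set δ : ℝ := 1 / (4 * ((K : ℝ) + 1)) with hδ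
  have hδ0 : 0 < δ := by positivity
  have hδK : δ * (4 * ((K : ℝ) + 1)) = 1 := by rw [hδ]; field_simp
  by_contra! hcon
  have hx : ∀ i ∈ Finset.range (K + 1), ∃ t ∈ T, |t - (x + (2 * i + 1) * δ)| < δ := by
    intro i hi
    have hi' : (i : ℝ) ≤ K := by exact_mod_cast Nat.lt_succ_iff.1 (Finset.mem_range.1 hi)
    refine hcon _ ⟨?_, ?_⟩
    · have : 0 ≤ (2 * (i : ℝ) + 1) * δ := by positivity
      linarith
    · nlinarith
  choose! f hf hfd using hx
  obtain ⟨i, hi, j, hj, hij, he⟩ := Finset.exists_ne_map_eq_of_card_lt_of_maps_to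
    (by rw [Finset.card_range]; omega) hf
  have h1 := hfd i hi
  have h2 := hfd j hj
  rw [he] at h1
  rw [abs_lt] at h1 h2
  rcases lt_or_gt_of_ne hij with h | h
  · have : (i : ℝ) + 1 ≤ j := by exact_mod_cast h
    nlinarith
  · have : (j : ℝ) + 1 ≤ i := by exact_mod_cast h
    nlinarith

end Core

/-! ### The resolvent applied to the control operator -/

section Resolvent

variable {H : Type*} [NormedAddCommGroup H] [InnerProductSpace ℂ H]
  {A : H →ₗ.[ℂ] H} {B : A.domain →ₛₗ[starRingEnd ℂ] ℂ} {φ : HilbertBasis ℕ ℂ H} {ev : ℕ → ℂ}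
  {α : ℝ}

theorem Framework.inner_adjoint_basis [CompleteSpace H] (hF : Framework A B φ ev α)
    (w : A†.domain) (p : ℕ) :
    inner ℂ (A† w) (φ p) = ev p * inner ℂ (w : H) (φ p) := by
  have h := LinearPMap.adjoint_isFormalAdjoint hF.dense_domain w ⟨φ p, hF.mem_domain p⟩
  rw [hF.eigen, inner_smul_right] at h
  exact h

/-- As `A` acts diagonally on the coefficients of `v`, the partial expansions of `v` converge in the
graph norm, for which `B` is continuous. -/
theorem Framework.hasSum_control (hF : Framework A B φ ev α)
    (hA : ∀ (v : A.domain) p, inner ℂ (φ p) (A v) = ev p * inner ℂ (φ p) (v : H)) (v : A.domain) :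
    HasSum (fun p => inner ℂ (v : H) (φ p) * B ⟨φ p, hF.mem_domain p⟩) (B v) := by
  obtain ⟨M, hM⟩ := hF.continuous_control
  set vS : Finset ℕ → A.domain := fun S =>
    ∑ p ∈ S, inner ℂ (φ p) (v : H) • (⟨φ p, hF.mem_domain p⟩ : A.domain) with hvS
  have h1 : Filter.Tendsto (fun S => (vS S : H)) Filter.atTop (nhds (v : H)) := by
    have h := φ.hasSum_repr (v : H)
    simp only [HilbertBasis.repr_apply_apply] at h
    refine Filter.Tendsto.congr (fun S => ?_) h
    simp [hvS]
  have h2 : Filter.Tendsto (fun S => A (vS S)) Filter.atTop (nhds (A v)) := by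
    have h := φ.hasSum_repr (A v)
    simp only [HilbertBasis.repr_apply_apply] at h
    refine Filter.Tendsto.congr (fun S => ?_) h
    change _ = A.toFun (vS S)
    rw [hvS, map_sum]
    refine Finset.sum_congr rfl fun p _ => ?_
    rw [map_smul]
    change inner ℂ (φ p) (A v) • φ p = _ • A ⟨φ p, hF.mem_domain p⟩
    rw [hA, hF.eigen, smul_smul, mul_comm]
  have h3 : ∀ S, B (vS S) = ∑ p ∈ S, inner ℂ (v : H) (φ p) * B ⟨φ p, hF.mem_domain p⟩ := by
    intro S
    rw [hvS, map_sum]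
    refine Finset.sum_congr rfl fun p _ => ?_
    rw [LinearMap.map_smulₛₗ, inner_conj_symm, smul_eq_mul]
  have h4 : Filter.Tendsto (fun S => B (vS S)) Filter.atTop (nhds (B v)) := by
    rw [tendsto_iff_norm_sub_tendsto_zero]
    have h5 : Filter.Tendsto (fun S => M * (‖(vS S : H) - v‖ + ‖A (vS S) - A v‖)) Filter.atTop
        (nhds (M * (0 + 0))) :=
      ((tendsto_iff_norm_sub_tendsto_zero.1 h1).add
        (tendsto_iff_norm_sub_tendsto_zero.1 h2)).const_mul M
    rw [add_zero, mul_zero] at h5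
    refine squeeze_zero (fun _ => norm_nonneg _) (fun S => ?_) h5
    have h6 := hM (vS S - v)
    rw [map_sub, LinearPMap.map_sub] at h6
    exact h6
  exact h4.congr h3

theorem Framework.exists_resolvent [CompleteSpace H] (hF : Framework A B φ ev α)
    (hA : ∀ (v : A.domain) p, inner ℂ (φ p) (A v) = ev p * inner ℂ (φ p) (v : H)) {z : ℂ}
    (hz : ∀ p, ev p - z ≠ 0)
    (hs : Summable fun p => B ⟨φ p, hF.mem_domain p⟩ / (ev p - z)) :
    ∃ g : H, IsResolventOfControl A B z g ∧
      ∀ p, inner ℂ (φ p) g = B ⟨φ p, hF.mem_domain p⟩ / (ev p - z) := by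
  have hmem : Memℓp (fun p => B ⟨φ p, hF.mem_domain p⟩ / (ev p - z)) 2 :=
    Memℓp.of_exponent_ge (q := 1) (memℓp_gen (by simpa using hs.norm)) (by norm_num)
  set g : H := φ.repr.symm ⟨_, hmem⟩ with hg
  have hgp : ∀ p, inner ℂ (φ p) g = B ⟨φ p, hF.mem_domain p⟩ / (ev p - z) := by
    intro p
    rw [← HilbertBasis.repr_apply_apply, hg, LinearIsometryEquiv.apply_symm_apply]
  refine ⟨g, fun v w hwv => ?_, hgp⟩
  refine (φ.hasSum_inner_mul_inner _ g).unique ((hF.hasSum_control hA v).congr_fun fun p => ?_)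
  rw [hgp, inner_sub_left, hF.inner_adjoint_basis, inner_smul_left, Complex.conj_conj, ← sub_mul,
    hwv]
  have := hz p
  field_simp

end Resolvent

/-! ### Eigenvalue growth, absorption of polynomial factors, choice of `lam` -/

section Assembly

variable {H : Type*} [NormedAddCommGroup H] [InnerProductSpace ℂ H]
  {A : H →ₗ.[ℂ] H} {B : A.domain →ₛₗ[starRingEnd ℂ] ℂ} {φ : HilbertBasis ℕ ℂ H} {ev : ℕ → ℂ}
  {α : ℝ}

theorem Framework.exists_growth_bounds (hF : Framework A B φ ev α) {μ : ℕ → ℝ} {ω : ℂ}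
    (hω : ‖ω‖ = 1) (hev : ∀ n, ev n = ω * μ n) (hμ0 : 0 < μ 0) (hμ : Monotone μ) :
    ∃ c₁ C₁ : ℝ, 0 < c₁ ∧
      ∀ n : ℕ, c₁ * ((n : ℝ) + 1) ^ α ≤ ‖ev n‖ ∧ ‖ev n‖ ≤ C₁ * ((n : ℝ) + 1) ^ α := by
  obtain ⟨_, C, _, hC⟩ := hF.growth
  obtain ⟨c, hc, hgap⟩ := hF.gap
  have hα := hF.one_lt_order
  have hnev : ∀ n, ‖ev n‖ = μ n := fun n => by
    rw [hev, norm_mul, hω, one_mul, Complex.norm_real,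
      Real.norm_of_nonneg (hμ0.le.trans (hμ n.zero_le))]
  have hdiff : ∀ k n, n ≤ k → ‖ev k - ev n‖ = μ k - μ n := fun k n h => by
    rw [hev, hev, ← mul_sub, norm_mul, hω, one_mul, ← Complex.ofReal_sub, Complex.norm_real,
      Real.norm_of_nonneg (sub_nonneg.2 (hμ h))]
  have hpow : ∀ n : ℕ, ((n : ℝ) + 1) ^ α = ((n : ℝ) + 1) ^ (α - 1) * ((n : ℝ) + 1) := fun n => by
    rw [← Real.rpow_add_one (by positivity), sub_add_cancel]
  have hone : ∀ n : ℕ, 1 ≤ ((n : ℝ) + 1) ^ (α - 1) := fun n =>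
    Real.one_le_rpow (by linarith [n.cast_nonneg (α := ℝ)]) (by linarith)
  -- The lower bound is the gap with index 0, the half coming from `n + 1 ≤ 2 n` for `n ≥ 1`; the
  -- upper bound telescopes the growth condition.
  refine ⟨min (μ 0) c / 2, μ 0 + |C|, by positivity, fun n => ?_⟩
  rw [hnev, hpow]
  have hX := hone n
  set X := ((n : ℝ) + 1) ^ (α - 1) with hXdef
  have hn : (0 : ℝ) ≤ n := n.cast_nonneg
  constructor
  · rcases Nat.eq_zero_or_pos n with rfl | hnpos
    · have hX1 : X = 1 := by simp [hXdef]
      rw [hX1]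
      have := min_le_left (μ 0) c
      simp only [Nat.cast_zero, zero_add, mul_one]
      linarith
    · have h1 := hgap n 0
      rw [hdiff n 0 n.zero_le] at h1
      simp only [Nat.cast_zero, sub_zero, abs_of_nonneg hn] at h1
      have hn1 : (1 : ℝ) ≤ n := by exact_mod_cast hnpos
      calc min (μ 0) c / 2 * (X * (n + 1)) ≤ c / 2 * (X * (2 * n)) := by
            gcongr
            · exact min_le_right _ _
            · linarith
        _ = c * X * n := by ring
        _ ≤ μ n := by linarith
  · have h1 : μ n - μ 0 ≤ n * (|C| * X) := by
      rw [← Finset.sum_range_sub]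
      refine (Finset.sum_le_card_nsmul (Finset.range n) _ (|C| * X) fun j hj => ?_).trans_eq
        (by rw [Finset.card_range, nsmul_eq_mul])
      have hj' : (j : ℝ) ≤ n := by exact_mod_cast (Finset.mem_range.1 hj).le
      rw [← hdiff (j + 1) j j.le_succ]
      refine (hC j).2.trans ?_
      have : ((j : ℝ) + 1) ^ (α - 1) ≤ X :=
        Real.rpow_le_rpow (by positivity) (by linarith) (by linarith)
      calc C * ((j : ℝ) + 1) ^ (α - 1) ≤ |C| * ((j : ℝ) + 1) ^ (α - 1) := by
            gcongr
            exact le_abs_self C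
        _ ≤ _ := by gcongr
    have h2 : 0 ≤ |C| * X := by positivity
    have h3 : μ 0 ≤ μ 0 * (X * (n + 1)) := by
      refine le_mul_of_one_le_right hμ0.le ?_
      nlinarith
    nlinarith

theorem Framework.exists_cost [CompleteSpace H] (hF : Framework A B φ ev α)
    (hA : ∀ (v : A.domain) p, inner ℂ (φ p) (A v) = ev p * inner ℂ (φ p) (v : H))
    {μ : ℕ → ℝ} {ω : ℂ} (hω : ‖ω‖ = 1) (hev : ∀ n, ev n = ω * μ n) (hμ0 : 0 < μ 0)
    (hμ : Monotone μ) {K r : ℝ} (hK : 0 ≤ K) (hr : 0 ≤ r) :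
    ∃ (C : ℝ) (Cs : ℝ → ℝ), ∀ lam δ : ℝ, 1 / 2 ≤ lam → 0 < δ → δ ≤ 1 →
      (∀ p n, δ ≤ ‖ev p - ev n - lam‖) → 1 / δ ≤ K * (1 + lam) ^ r →
      TransformationCost A B φ ev (fun n => B ⟨φ n, hF.mem_domain n⟩) α C Cs lam := by
  obtain ⟨c₁, C₁, hc₁, hgrowth⟩ := hF.exists_growth_bounds hω hev hμ0 hμ
  obtain ⟨c, hc, hgap⟩ := hF.gap
  obtain ⟨cb, Cb, hcb, hb⟩ := hF.control_bounds
  obtain ⟨C, Cs, hCs, hT⟩ := exists_transformation hF.one_lt_order hc hgap hc₁ hgrowth hcb hb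
  obtain ⟨K', hK', hexp⟩ := exists_one_add_rpow_le_exp (r := r + 2) hF.one_lt_order (by linarith)
  -- The factor `lam ^ 2 / δ` is at most a constant times `exp (lam^{1/α})`, which raises `C` by 1.
  refine ⟨C + 1, fun s => Cs s * (K * K'), fun lam δ hlam hδ hδ1 hres hδK => ?_⟩
  have hlam0 : 0 < lam := by linarith
  obtain ⟨huniq, hsum, hiso⟩ := hT lam δ hlam hδ hδ1 hres
  have hne : ∀ p n, ev p - ev n - lam ≠ 0 := fun p n => norm_pos_iff.1 (hδ.trans_le (hres p n))
  refine ⟨hlam0, fun i j h => hne i j (by rw [h, sub_self]), huniq, fun s hs => ?_⟩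
  obtain ⟨T, hTb, hTn⟩ := hiso s hs
  refine ⟨T, fun n => ?_, hTn.trans ?_⟩
  · obtain ⟨g, hg, hgp⟩ := hF.exists_resolvent hA (z := ev n + lam)
      (fun p => by rw [← sub_sub]; exact hne p n) (by simpa only [sub_sub] using hsum n)
    refine ⟨g, hg, fun p => ?_⟩
    rw [hTb, hgp, sub_sub]
  · have h1 : lam ^ 2 / δ ≤ K * K' * Real.exp (lam ^ (1 / α)) := by
      have h2 : lam ^ 2 ≤ (1 + lam) ^ (2 : ℝ) := by
        rw [Real.rpow_two]
        gcongr
        linarith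
      calc lam ^ 2 / δ = lam ^ 2 * (1 / δ) := by ring
        _ ≤ (1 + lam) ^ (2 : ℝ) * (K * (1 + lam) ^ r) := by gcongr
        _ = K * (1 + lam) ^ (r + 2) := by rw [Real.rpow_add (by linarith)]; ring
        _ ≤ K * (K' * Real.exp (lam ^ (1 / α))) := by
          have := hexp lam hlam0.le
          gcongr
        _ = _ := by ring
    have h3 := hCs s
    calc Cs s * (lam ^ 2 / δ) * Real.exp (C * lam ^ (1 / α))
        ≤ Cs s * (K * K' * Real.exp (lam ^ (1 / α))) * Real.exp (C * lam ^ (1 / α)) := by gcongr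
      _ = Cs s * (K * K') * (Real.exp (lam ^ (1 / α)) * Real.exp (C * lam ^ (1 / α))) := by ring
      _ = _ := by rw [← Real.exp_add]; congr 2; ring

/-- A difference involving an index at least `L`, of order `N^{1/(α-1)}`, has size at least `N + 2`,
hence is at distance at least 1 from `[N, N + 1]`. Only `L ^ 2` differences remain to be avoided. -/
theorem exists_nonresonant_separated {μ : ℕ → ℝ} {c : ℝ} (hα : 1 < α) (hc : 0 < c)
    (hgap : ∀ k n : ℕ, c * ((k : ℝ) + 1) ^ (α - 1) * |(k : ℝ) - n| ≤ |μ k - μ n|) :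
    ∃ K r : ℝ, 0 ≤ K ∧ 0 ≤ r ∧ ∀ N : ℕ, ∃ lam ∈ Set.Icc (N : ℝ) (N + 1), 1 / 2 ≤ lam ∧
      ∃ δ : ℝ, 0 < δ ∧ δ ≤ 1 ∧ (∀ p n, δ ≤ |μ p - μ n - lam|) ∧ 1 / δ ≤ K * (1 + lam) ^ r := by
  set q := 1 / (α - 1) with hq
  have hα1 : 0 < α - 1 := by linarith
  have hq0 : 0 < q := by positivity
  set κ := (2 / c) ^ q + 1 with hκ
  refine ⟨4 * (κ ^ 2 + 1), 2 * q, by positivity, by positivity, fun N => ?_⟩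
  set X := (((N : ℝ) + 2) / c) ^ q with hX
  set L := ⌈X⌉₊ with hL
  have hN : (0 : ℝ) ≤ N := N.cast_nonneg
  set T := (Finset.range L ×ˢ Finset.range L).image fun i => μ i.1 - μ i.2 with hT
  have hcard : T.card ≤ L ^ 2 := by
    refine Finset.card_image_le.trans ?_
    rw [Finset.card_product, Finset.card_range, sq]
  -- Starting at `N + 1/2` keeps `lam ≥ 1/2` even for `N = 0`; this also separates `lam` from the
  -- zero differences `p = n`.
  obtain ⟨lam, ⟨hl1, hl2⟩, hsep⟩ := exists_separated T hcard ((N : ℝ) + 1 / 2)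
  have hδ1 : 1 / (4 * (((L ^ 2 : ℕ) : ℝ) + 1)) ≤ 1 / 2 := by
    apply one_div_le_one_div_of_le (by norm_num)
    have : (0 : ℝ) ≤ ((L ^ 2 : ℕ) : ℝ) := Nat.cast_nonneg _
    linarith
  refine ⟨lam, ⟨by linarith, by linarith⟩, by linarith, _, by positivity,
    hδ1.trans (by norm_num), fun p n => ?_, ?_⟩
  · have hbig : ∀ k l : ℕ, L ≤ k → k ≠ l → (N : ℝ) + 2 ≤ |μ k - μ l| := by
      intro k l hk hkl
      refine le_trans ?_ (hgap k l)
      have h1 : 1 ≤ |(k : ℝ) - l| := by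
        have : (1 : ℤ) ≤ |(k : ℤ) - l| := Int.one_le_abs (by omega)
        exact_mod_cast this
      have h2 : X ≤ (k : ℝ) + 1 := by
        have h3 : (L : ℝ) ≤ k := by exact_mod_cast hk
        linarith [Nat.le_ceil X]
      have h4 : ((N : ℝ) + 2) / c ≤ ((k : ℝ) + 1) ^ (α - 1) := by
        have h := Real.rpow_le_rpow (by positivity) h2 hα1.le
        rwa [hX, ← Real.rpow_mul (by positivity), hq, one_div_mul_cancel hα1.ne',
          Real.rpow_one] at h
      rw [div_le_iff₀' hc] at h4
      nlinarith
    rcases eq_or_ne p n with rfl | hpn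
    · rw [sub_self, zero_sub, abs_neg, abs_of_nonneg (by linarith)]
      linarith
    have hfar : (N : ℝ) + 2 ≤ |μ p - μ n| →
        1 / (4 * (((L ^ 2 : ℕ) : ℝ) + 1)) ≤ |μ p - μ n - lam| := by
      intro h
      have h1 := abs_sub_abs_le_abs_sub (μ p - μ n) lam
      rw [abs_of_nonneg (show 0 ≤ lam by linarith)] at h1
      linarith
    rcases le_or_gt L p with hp | hp
    · exact hfar (hbig p n hp hpn)
    rcases le_or_gt L n with hn | hn
    · exact hfar (by rw [abs_sub_comm]; exact hbig n p hn hpn.symm)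
    exact hsep _ (Finset.mem_image.2
      ⟨(p, n), Finset.mem_product.2 ⟨Finset.mem_range.2 hp, Finset.mem_range.2 hn⟩, rfl⟩)
  · have hl0 : 1 ≤ 1 + lam := by linarith
    have h1 : X ≤ (2 / c) ^ q * (1 + lam) ^ q := by
      rw [← Real.mul_rpow (by positivity) (by linarith)]
      refine Real.rpow_le_rpow (by positivity) ?_ hq0.le
      rw [div_mul_eq_mul_div]
      gcongr
      linarith
    have h2 : 1 ≤ (1 + lam) ^ q := Real.one_le_rpow hl0 hq0.le
    have h3 : (L : ℝ) ≤ κ * (1 + lam) ^ q := by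
      have := (Nat.ceil_lt_add_one (show 0 ≤ X by positivity)).le
      rw [hκ]
      linarith
    have h4 : (1 + lam) ^ (2 * q) = ((1 + lam) ^ q) ^ 2 := by
      rw [mul_comm, Real.rpow_mul (by linarith), Real.rpow_two]
    rw [one_div_one_div, h4]
    push_cast
    have h5 : (L : ℝ) ^ 2 ≤ (κ * (1 + lam) ^ q) ^ 2 := by gcongr
    nlinarith

end Assembly

end Backstepping

theorem mainTheorem2 {H : Type*} [NormedAddCommGroup H] [InnerProductSpace ℂ H] [CompleteSpace H]
    (A : H →ₗ.[ℂ] H) (B : A.domain →ₛₗ[starRingEnd ℂ] ℂ)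
    (φ : HilbertBasis ℕ ℂ H) (ev : ℕ → ℂ) (α : ℝ)
    (hF : Backstepping.Framework A B φ ev α) :
    (Backstepping.SelfAdjointCase A ev →
      ∃ (C : ℝ) (Cs : ℝ → ℝ), ∀ N : ℕ, ∃ lam ∈ Set.Icc (N : ℝ) (N + 1),
        Backstepping.TransformationCost A B φ ev (fun n => B ⟨φ n, hF.mem_domain n⟩) α C Cs lam) ∧
    (Backstepping.SkewAdjointCase A ev →
      ∃ (C : ℝ) (Cs : ℝ → ℝ), ∀ lam : ℝ, 1 ≤ lam →
        Backstepping.TransformationCost A B φ ev (fun n => B ⟨φ n, hF.mem_domain n⟩) α C Cs lam) := by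
  constructor
  · rintro ⟨hadj, μ, hμ, hμ0, hmono, -⟩
    have hev : ∀ n, ev n = -1 * μ n := fun n => by rw [← hμ]; ring
    have hA : ∀ (v : A.domain) p, inner ℂ (φ p) (A v) = ev p * inner ℂ (φ p) (v : H) := by
      intro v p
      obtain ⟨hdom, happ⟩ := LinearPMap.ext_iff.1 hadj
      have hv : (v : H) ∈ A†.domain := by rw [hdom]; exact v.2
      have h := hF.inner_adjoint_basis ⟨v, hv⟩ p
      rw [happ (hg := v.2)] at h
      rw [← inner_conj_symm, h, map_mul, inner_conj_symm, hev]
      simp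
    obtain ⟨c, hc, hgap⟩ := hF.gap
    have hgap' : ∀ k n : ℕ, c * ((k : ℝ) + 1) ^ (α - 1) * |(k : ℝ) - n| ≤ |μ k - μ n| := by
      intro k n
      refine (hgap k n).trans_eq ?_
      rw [hev, hev, ← mul_sub, norm_mul, norm_neg, norm_one, one_mul, ← Complex.ofReal_sub,
        Complex.norm_real, Real.norm_eq_abs]
    obtain ⟨K, r, hK, hr, hsep⟩ :=
      Backstepping.exists_nonresonant_separated hF.one_lt_order hc hgap'
    obtain ⟨C, Cs, hcost⟩ := hF.exists_cost hA (by simp) hev hμ0 hmono hK hr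
    refine ⟨C, Cs, fun N => ?_⟩
    obtain ⟨lam, hlam, hlam2, δ, hδ, hδ1, hres, hδK⟩ := hsep N
    -- The indices are swapped because `ev = -μ`.
    refine ⟨lam, hlam, hcost lam δ hlam2 hδ hδ1 (fun p n => (hres n p).trans_eq ?_) hδK⟩
    have e : ev p - ev n - lam = ((μ n - μ p - lam : ℝ) : ℂ) := by
      rw [hev, hev]
      push_cast
      ring
    rw [e, Complex.norm_real, Real.norm_eq_abs]
  · rintro ⟨hadj, μ, hμ, hμ0, hmono, -⟩
    have hev : ∀ n, ev n = Complex.I * μ n := fun n => by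
      rw [← hμ, mul_neg, ← mul_assoc, Complex.I_mul_I]
      ring
    have hA : ∀ (v : A.domain) p, inner ℂ (φ p) (A v) = ev p * inner ℂ (φ p) (v : H) := by
      intro v p
      obtain ⟨hdom, happ⟩ := LinearPMap.ext_iff.1 hadj
      have hv : (v : H) ∈ A†.domain := by rw [hdom]; exact v.2
      have h := hF.inner_adjoint_basis ⟨v, hv⟩ p
      rw [happ (hg := v.2), LinearPMap.neg_apply, inner_neg_left] at h
      change -inner ℂ (A v) (φ p) = ev p * inner ℂ (v : H) (φ p) at h
      rw [← inner_conj_symm, ← neg_neg (inner ℂ (A v) (φ p)), h, map_neg, map_mul,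
        inner_conj_symm, hev]
      simp
    -- The differences of eigenvalues are purely imaginary, so `|ev p - ev n - lam| ≥ lam ≥ 1` and
    -- `δ = 1`, `K = 1`, `r = 0` are admissible.
    obtain ⟨C, Cs, hcost⟩ :=
      hF.exists_cost hA Complex.norm_I hev hμ0 hmono zero_le_one (le_refl (0 : ℝ))
    refine ⟨C, Cs, fun lam hlam => hcost lam 1 (by linarith) one_pos le_rfl (fun p n => ?_)
      (by simp)⟩
    have h := Complex.abs_re_le_norm (ev p - ev n - lam)
    have e : (ev p - ev n - lam).re = -lam := by
      rw [hev, hev]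
      simp
    rw [e, abs_neg, abs_of_nonneg (by linarith)] at h
    linarith
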